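/- Let $M$ be an $n$-dimensional smooth manifold (Hausdorff, second countable) with a smooth volume $dx$, let $X_1,\dots,X_N$ be smooth vector fields on $M$, and write $\nabla_X=(X_1,\dots,X_N)$, with $X_k^*$ the formal adjoint of $X_k$ with respect to $dx$. Let $\Omega\subset M$ be open with compact closure, and let $p:\overline\Omega\to(1,\infty)$ be continuous on $\overline\Omega$ and of class $C^1$ in $\Omega$. Let $W^{1,p(x)}(\Omega)$ be the space of $u\in L^{p(x)}(\Omega)$ whose weak horizontal gradient $\nabla_Xu$ (defined by $\int_\Omega u\,X_k^*\phi\,dx=\int_\Omega (X_ku)\,\phi\,dx$ for $\phi\in C_c^\infty(\Omega)$) is in $L^{p(x)}(\Omega)$, and let $W_0^{1,p(x)}(\Omega)$ be the closure of $C_c^\infty(\Omega)$ in it for the norm $\|u\|_{L^{p(x)}}+\|\nabla_Xu\|_{L^{p(x)}}$ (Luxemburg norms). Let $C^1_0(\Omega)$ be the set of functions of class $C^1$ in $\Omega$ that are continuous on $\overline\Omega$ and vanish on $\partial\Omega$ (it contains the compactly supported $C^1$ functions). (1) Let $\mu>0$, let $a$ be a positive continuous function on $\Omega$, and let $f:(0,\infty)\to(0,\infty)$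 be of class $C^1$ with $$f'(y)\ \ge\ (p(x)-1)\,f(y)^{\frac{p(x)-2}{p(x)-1}}\qquad\text{for all } y>0,\ x\in\Omega .$$ Suppose that $v\in C^\infty(\Omega)\cap W_0^{1,p(x)}(\Omega)$ satisfies $v>0$ and $\langle\nabla_Xv,\nabla_Xp\rangle= 0$ everywhere in $\Omega$, and is a weak solution of the Dirichlet problem for the $p(x)$-sub-Laplacian with right-hand side $\mu a f(v)$, that is, $$\int_\Omega|\nabla_Xv|^{p(x)-2}\langle\nabla_Xv,\nabla_X\phi\rangle\,dx=\mu\int_\Omega a(x)f(v)\,\phi\,dx\qquad\text{for all }\phi\in C_c^\infty(\Omega).$$ Then for every $u\in C^1_0(\Omega)$ with $u\ge 0$, $$\int_\Omega|\nabla_Xu|^{p(x)}\,dx\ \ge\ \mu\int_\Omega a(x)\,|u|^{p(x)}\,dx ,$$ as an inequality in $[0,\infty]$. (2) Let $\lambda>0$ and let $g$ be a positive bounded measurable function on $\Omega$. Suppose that there is a strictly positive (a.e.) sup-solution $v\in W_0^{1,p(x)}(\Omega)$ of the weighted eigenvalue problem, that is, $$\int_\Omega|\nabla_Xv|^{p(x)-2}\langle\nabla_Xv,\nabla_X\phi\rangle\,dx\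 \ge\ \lambda\int_\Omega g(x)|v|^{p(x)-2}v\,\phi\,dx\qquad\text{for all }\phi\in C_c^\infty(\Omega),\ \phi\ge0,$$ with $\langle\nabla_Xv,\nabla_Xp\rangle=0$ a.e. in $\Omega$. Then for every $u\in W_0^{1,p(x)}(\Omega)$, $$\int_\Omega|\nabla_Xu|^{p(x)}\,dx\ \ge\ \lambda\int_\Omega g(x)\,|u|^{p(x)}\,dx .$$ -/

import Mathlib

open MeasureTheory Set
open scoped Manifold ContDiff ENNReal

noncomputable section

section SubRiemannian

/-- A smooth volume on an `n`-dimensional manifold: a measure which, in each preferred chart, has a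
smooth positive density with respect to Lebesgue measure (the local expression `ρ dx₁ ⋯ dxₙ` of a
volume form). -/
structure SmoothVolume (n : ℕ) (M : Type*) [TopologicalSpace M]
    [ChartedSpace (EuclideanSpace ℝ (Fin n)) M] [MeasurableSpace M] where
  /-- the measure `dx` on `M` -/
  measure : Measure M
  /-- `density x` is the local density in the chart `chartAt _ x` -/
  density : M → EuclideanSpace ℝ (Fin n) → ℝ
  density_smooth : ∀ x, ContDiffOn ℝ ∞ (density x) (chartAt (EuclideanSpace ℝ (Fin n)) x).target
  density_pos : ∀ x, ∀ y ∈ (chartAt (EuclideanSpace ℝ (Fin n)) x).target, 0 < density x y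
  map_chart : ∀ x,
    (measure.restrict (chartAt (EuclideanSpace ℝ (Fin n)) x).source).map
        (chartAt (EuclideanSpace ℝ (Fin n)) x) =
      (volume.restrict (chartAt (EuclideanSpace ℝ (Fin n)) x).target).withDensity
        (fun y => ENNReal.ofReal (density x y))

variable {n N : ℕ} {M : Type*} [TopologicalSpace M] [ChartedSpace (EuclideanSpace ℝ (Fin n)) M]

/-- The horizontal gradient `∇_X φ = (X₁ φ, …, X_N φ)` of a differentiable function. -/
def horizGrad (X : Fin N → (x : M) → TangentSpace (𝓡 n) x) (φ : M → ℝ) (x : M) :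
    EuclideanSpace ℝ (Fin N) :=
  WithLp.toLp 2 (fun k => (mfderiv (𝓡 n) 𝓘(ℝ, ℝ) φ x (X k x) : ℝ))

/-- `C_c^∞(Ω)`: smooth functions with compact support contained in `Ω`. -/
def IsTestFunction (Ω : Set M) (φ : M → ℝ) : Prop :=
  ContMDiff (𝓡 n) 𝓘(ℝ, ℝ) ∞ φ ∧ HasCompactSupport φ ∧ tsupport φ ⊆ Ω

/-- `C¹₀(Ω)`: functions of class `C¹` in `Ω`, continuous on the closure and zero on the boundary.
Every `C¹` function with compact support in `Ω` belongs to this class. -/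
def IsC1Zero (Ω : Set M) (u : M → ℝ) : Prop :=
  ContMDiffOn (𝓡 n) 𝓘(ℝ, ℝ) 1 u Ω ∧ ContinuousOn u (closure Ω) ∧ ∀ x ∈ frontier Ω, u x = 0

/-- The coefficient vector `(a₁, …, aₙ)` at the coordinate point `y` of the vector field
`Y = ∑ⱼ aⱼ ∂ⱼ`, in the chart at `x`. -/
def chartCoeff (Y : (x : M) → TangentSpace (𝓡 n) x) (x : M) (y : EuclideanSpace ℝ (Fin n)) :
    EuclideanSpace ℝ (Fin n) :=
  mfderiv (𝓡 n) 𝓘(ℝ, EuclideanSpace ℝ (Fin n)) (chartAt (EuclideanSpace ℝ (Fin n)) x)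
    ((chartAt (EuclideanSpace ℝ (Fin n)) x).symm y)
    (Y ((chartAt (EuclideanSpace ℝ (Fin n)) x).symm y))

variable [MeasurableSpace M]

/-- The formal adjoint `Y* φ = - ρ⁻¹ ∑ⱼ ∂ⱼ (ρ aⱼ φ)` of a vector field `Y = ∑ⱼ aⱼ ∂ⱼ` with
respect to the volume `ρ dx₁ ⋯ dxₙ`, computed at `x` in the chart at `x`. -/
def formalAdjoint (vol : SmoothVolume n M) (Y : (x : M) → TangentSpace (𝓡 n) x) (φ : M → ℝ)
    (x : M) : ℝ :=
  -(vol.density x (chartAt (EuclideanSpace ℝ (Fin n)) x x))⁻¹ *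
    ∑ j : Fin n,
      fderiv ℝ
        (fun y => vol.density x y * (chartCoeff Y x y) j *
          φ ((chartAt (EuclideanSpace ℝ (Fin n)) x).symm y))
        (chartAt (EuclideanSpace ℝ (Fin n)) x x) (EuclideanSpace.single j 1)

/-- The modular `∫_Ω |F|^{p(x)} dx`, as an extended nonnegative number. -/
def modular {V : Type*} [NormedAddCommGroup V] (vol : SmoothVolume n M) (Ω : Set M) (p : M → ℝ)
    (F : M → V) : ℝ≥0∞ :=
  ∫⁻ x in Ω, ENNReal.ofReal (‖F x‖ ^ p x) ∂vol.measure

/-- Membership in the variable exponent Lebesgue space `L^{p(·)}(Ω)`. -/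
def MemVarLp {V : Type*} [NormedAddCommGroup V] (vol : SmoothVolume n M) (Ω : Set M) (p : M → ℝ)
    (F : M → V) : Prop :=
  AEStronglyMeasurable F (vol.measure.restrict Ω) ∧ modular vol Ω p F < ⊤

/-- The Luxemburg norm on `L^{p(·)}(Ω)`. -/
def luxNorm {V : Type*} [NormedAddCommGroup V] [NormedSpace ℝ V] (vol : SmoothVolume n M)
    (Ω : Set M) (p : M → ℝ) (F : M → V) : ℝ :=
  sInf {t : ℝ | 0 < t ∧ modular vol Ω p (fun x => t⁻¹ • F x) ≤ 1}

/-- `G` is the weak horizontal gradient of `u` in `Ω`: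
`∫_Ω u X_k* φ dx = ∫_Ω G_k φ dx` for all `k` and all `φ ∈ C_c^∞(Ω)`. -/
def IsWeakHorizGrad (X : Fin N → (x : M) → TangentSpace (𝓡 n) x) (vol : SmoothVolume n M)
    (Ω : Set M) (u : M → ℝ) (G : M → EuclideanSpace ℝ (Fin N)) : Prop :=
  ∀ k, ∀ φ : M → ℝ, IsTestFunction (n := n) Ω φ →
    ∫ x in Ω, u x * formalAdjoint vol (X k) φ x ∂vol.measure =
      ∫ x in Ω, (G x) k * φ x ∂vol.measure

/-- `u ∈ W^{1,p(·)}(Ω)`, with weak horizontal gradient `∇_X u = G`. -/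
def MemW1 (X : Fin N → (x : M) → TangentSpace (𝓡 n) x) (vol : SmoothVolume n M) (Ω : Set M)
    (p : M → ℝ) (u : M → ℝ) (G : M → EuclideanSpace ℝ (Fin N)) : Prop :=
  MemVarLp vol Ω p u ∧ MemVarLp vol Ω p G ∧ IsWeakHorizGrad X vol Ω u G

/-- `u ∈ W_0^{1,p(·)}(Ω)`, with weak horizontal gradient `∇_X u = G`: `u` lies in the closure of
`C_c^∞(Ω)` in `W^{1,p(·)}(Ω)`. -/
def MemW10 (X : Fin N → (x : M) → TangentSpace (𝓡 n) x) (vol : SmoothVolume n M) (Ω : Set M)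
    (p : M → ℝ) (u : M → ℝ) (G : M → EuclideanSpace ℝ (Fin N)) : Prop :=
  MemW1 X vol Ω p u G ∧
    ∀ ε > 0, ∃ φ : M → ℝ, IsTestFunction (n := n) Ω φ ∧
      luxNorm vol Ω p (fun x => u x - φ x) + luxNorm vol Ω p (fun x => G x - horizGrad X φ x) < ε

/-- The weak form `∫_Ω |G|^{p(x)-2} ⟨G, ∇_X φ⟩ dx` of the `p(x)`-sub-Laplacian of a function with
horizontal gradient `G`, tested against `φ`. -/
def pSubLaplaceForm (X : Fin N → (x : M) → TangentSpace (𝓡 n) x) (vol : SmoothVolume n M)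
    (Ω : Set M) (p : M → ℝ) (G : M → EuclideanSpace ℝ (Fin N)) (φ : M → ℝ) : ℝ :=
  ∫ x in Ω, ‖G x‖ ^ (p x - 2) * inner ℝ (G x) (horizGrad X φ x) ∂vol.measure

/-- `v ∈ C^∞(Ω) ∩ W_0^{1,p(·)}(Ω)` is a positive weak solution of the Dirichlet problem for the
`p(x)`-sub-Laplacian with right-hand side `c a(x) f(v)`. Testing is against `C_c^∞(Ω)` only. -/
structure IsPositiveSolution (X : Fin N → (x : M) → TangentSpace (𝓡 n) x) (vol : SmoothVolume n M)
    (Ω : Set M) (p : M → ℝ) (c : ℝ) (a : M → ℝ) (f : ℝ → ℝ) (v : M → ℝ) : Prop where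
  smooth : ContMDiffOn (𝓡 n) 𝓘(ℝ, ℝ) ∞ v Ω
  memW10 : MemW10 X vol Ω p v (horizGrad X v)
  pos : ∀ x ∈ Ω, 0 < v x
  weak_eq : ∀ φ : M → ℝ, IsTestFunction (n := n) Ω φ →
    pSubLaplaceForm X vol Ω p (horizGrad X v) φ = c * ∫ x in Ω, a x * f (v x) * φ x ∂vol.measure

/-- `v ∈ W_0^{1,p(·)}(Ω)`, with `∇_X v = G`, is a strictly positive sup-solution of the weighted
eigenvalue problem with parameter `lam` and weight `g`. Testing is against nonnegative functions
of `C_c^∞(Ω)` only. -/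
structure IsPositiveSupSolution (X : Fin N → (x : M) → TangentSpace (𝓡 n) x)
    (vol : SmoothVolume n M) (Ω : Set M) (p : M → ℝ) (lam : ℝ) (g : M → ℝ) (v : M → ℝ)
    (G : M → EuclideanSpace ℝ (Fin N)) : Prop where
  memW10 : MemW10 X vol Ω p v G
  pos : ∀ᵐ x ∂(vol.measure.restrict Ω), 0 < v x
  weak_ge : ∀ φ : M → ℝ, IsTestFunction (n := n) Ω φ → (∀ x, 0 ≤ φ x) →
    lam * ∫ x in Ω, g x * (|v x| ^ (p x - 2) * v x) * φ x ∂vol.measure ≤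
      pSubLaplaceForm X vol Ω p G φ

/-- The Picone growth condition: `f : (0,∞) → (0,∞)` is `C¹` and
`f'(y) ≥ (p(x) - 1) f(y)^{(p(x)-2)/(p(x)-1)}` for all `y > 0` and `x ∈ Ω`. -/
structure PiconeGrowth (Ω : Set M) (p : M → ℝ) (f : ℝ → ℝ) : Prop where
  contDiffOn : ContDiffOn ℝ 1 f (Ioi 0)
  pos : ∀ y > 0, 0 < f y
  deriv_ge : ∀ x ∈ Ω, ∀ y > 0, (p x - 1) * f y ^ ((p x - 2) / (p x - 1)) ≤ deriv f y

end SubRiemannian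

end

/-!
Both inequalities come from Picone's identity. Test the equation of `v` with
`ψ = |u|^p / F`, where `F` is `f(v)` in the first part and `(v + ε)^{p-1}` in the second. The chain
rule gives
`∇ψ = (p |u|^{p-2} u / F) ∇u - (|u|^p F_v / F²) ∇v + γ ∇p`,
where the scalar `γ` collects the logarithms caused by the variable exponent. Orthogonality of `∇v`
and `∇p` makes `γ` irrelevant, and the growth condition `F_v ≥ (p - 1) F^{(p-2)/(p-1)}` reduces
`|∇v|^{p-2} ⟨∇v, ∇ψ⟩ ≤ |∇u|^p` to Young's inequality (`picone_pointwise`). What remains is to justify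
`ψ` as a test function.

* The exponent being only `C¹`, `ψ` is only `C¹`. A compactly supported nonnegative `C¹` function is
  a limit, uniformly together with its horizontal gradient, of nonnegative test functions
  (`exists_test_approx`: partition of unity, then mollification in charts), so the weak inequality
  extends to such functions (`weak_ineq_of_contMDiff_one`).
* In the first part, a function of class `C¹₀` is first truncated smoothly near zero, which makes its
  support compact without increasing the gradient; Fatou's lemma removes the truncation.
* In the second part `v` is only a Sobolev function. It is replaced in `F` by test functions `V k`
  converging to it in `W₀^{1,p(·)}`, and the inequality obtained from
  `|φ|^p / (softShift ε ∘ V k)^{p-1}` passes to the limit by dominated convergence: the coefficients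
  are bounded, and the error `∇(V k) - G` is controlled by Young's inequality
  (`IsPositiveSupSolution.picone_shift`). Then `ε → 0` by Fatou's lemma, and a general `u` is reached
  by density of test functions. Weak gradients enter only as limits of gradients of test functions.
-/

/-! ### Smooth volumes and horizontal gradients -/

section Basic

open Filter Topology

variable {n N : ℕ} {M : Type*} [TopologicalSpace M] [ChartedSpace (EuclideanSpace ℝ (Fin n)) M]

/-- A smooth volume is locally finite: its density is bounded on small closed balls of a chart. -/
theorem SmoothVolume.isLocallyFiniteMeasure [MeasurableSpace M] [BorelSpace M]
    (vol : SmoothVolume n M) : IsLocallyFiniteMeasure vol.measure := by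
  refine ⟨fun x => ?_⟩
  set e := chartAt (EuclideanSpace ℝ (Fin n)) x
  have hx : x ∈ e.source := mem_chart_source _ x
  obtain ⟨r, hr, hrs⟩ := Metric.nhds_basis_closedBall.mem_iff.1
    (e.open_target.mem_nhds (e.map_source hx))
  set B := Metric.closedBall (e x) r
  have hB : IsCompact B := isCompact_closedBall _ _
  refine ⟨e.source ∩ e ⁻¹' B, e.continuousAt hx |>.preimage_mem_nhds
    (Metric.closedBall_mem_nhds _ hr) |> inter_mem (e.open_source.mem_nhds hx), ?_⟩
  have hem : AEMeasurable e (vol.measure.restrict e.source) :=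
    e.continuousOn.aemeasurable e.open_source.measurableSet
  have h1 : vol.measure (e.source ∩ e ⁻¹' B) =
      ((vol.measure.restrict e.source).map e) B := by
    rw [Measure.map_apply_of_aemeasurable hem hB.measurableSet,
      Measure.restrict_apply' e.open_source.measurableSet, inter_comm]
  obtain ⟨C, hC⟩ := (hB.image_of_continuousOn
    ((vol.density_smooth x).continuousOn.mono hrs)).bddAbove
  rw [h1, vol.map_chart x, withDensity_apply _ hB.measurableSet,
    Measure.restrict_restrict hB.measurableSet, inter_eq_left.2 hrs]
  calc ∫⁻ y in B, ENNReal.ofReal (vol.density x y)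
      ≤ ∫⁻ _ in B, ENNReal.ofReal C := by
        refine setLIntegral_mono' hB.measurableSet fun y hy => ?_
        exact ENNReal.ofReal_le_ofReal (hC (mem_image_of_mem _ hy))
    _ < ⊤ := by
        rw [setLIntegral_const]
        exact ENNReal.mul_lt_top ENNReal.ofReal_lt_top hB.measure_lt_top

variable {X : Fin N → (x : M) → TangentSpace (𝓡 n) x}

theorem horizGrad_congr {f g : M → ℝ} {x : M} (h : f =ᶠ[𝓝 x] g) :
    horizGrad X f x = horizGrad X g x := by
  simp only [horizGrad, h.mfderiv_eq]
  rfl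

theorem horizGrad_eq_zero {f : M → ℝ} {x : M} (h : f =ᶠ[𝓝 x] fun _ => 0) :
    horizGrad X f x = 0 := by
  rw [horizGrad_congr h]
  ext k
  simp only [horizGrad, mfderiv_const]
  rfl

theorem horizGrad_add {f g : M → ℝ} {x : M} (hf : MDifferentiableAt (𝓡 n) 𝓘(ℝ, ℝ) f x)
    (hg : MDifferentiableAt (𝓡 n) 𝓘(ℝ, ℝ) g x) :
    horizGrad X (fun y => f y + g y) x = horizGrad X f x + horizGrad X g x := by
  ext k
  simp only [horizGrad]
  have := (hf.hasMFDerivAt.add hg.hasMFDerivAt).mfderiv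
  change (mfderiv (𝓡 n) 𝓘(ℝ, ℝ) (f + g) x) (X k x) = _
  rw [this]
  rfl

theorem horizGrad_sum {ι : Type*} {s : Finset ι} {f : ι → M → ℝ} {x : M}
    (hf : ∀ i ∈ s, MDifferentiableAt (𝓡 n) 𝓘(ℝ, ℝ) (f i) x) :
    MDifferentiableAt (𝓡 n) 𝓘(ℝ, ℝ) (fun y => ∑ i ∈ s, f i y) x ∧
      horizGrad X (fun y => ∑ i ∈ s, f i y) x = ∑ i ∈ s, horizGrad X (f i) x := by
  classical
  induction s using Finset.induction_on with
  | empty =>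
    simp only [Finset.sum_empty]
    exact ⟨mdifferentiableAt_const, horizGrad_eq_zero EventuallyEq.rfl⟩
  | insert a t ha ih =>
    simp only [Finset.sum_insert ha]
    obtain ⟨h1, h2⟩ := ih fun i hi => hf i (by simp [hi])
    have h3 := hf a (by simp)
    exact ⟨h3.add h1, by rw [horizGrad_add h3 h1, h2]⟩

/-- Chain rule for a function of three real variables. -/
theorem horizGrad_comp₃ {u q w : M → ℝ} {x : M} {Φ : ℝ × ℝ × ℝ → ℝ} {L : ℝ × ℝ × ℝ →L[ℝ] ℝ}
    (hΦ : HasFDerivAt Φ L (u x, q x, w x))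
    (hu : MDifferentiableAt (𝓡 n) 𝓘(ℝ, ℝ) u x) (hq : MDifferentiableAt (𝓡 n) 𝓘(ℝ, ℝ) q x)
    (hw : MDifferentiableAt (𝓡 n) 𝓘(ℝ, ℝ) w x) :
    horizGrad X (fun y => Φ (u y, q y, w y)) x =
      L (1, 0, 0) • horizGrad X u x + L (0, 1, 0) • horizGrad X q x +
        L (0, 0, 1) • horizGrad X w x := by
  have hu' := hu.hasMFDerivAt
  have hq' := hq.hasMFDerivAt
  have hw' := hw.hasMFDerivAt
  have h1 : HasMFDerivAt (𝓡 n) 𝓘(ℝ, ℝ × ℝ × ℝ) (fun y => (u y, q y, w y)) x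
      (ContinuousLinearMap.prod (mfderiv (𝓡 n) 𝓘(ℝ, ℝ) u x : EuclideanSpace ℝ (Fin n) →L[ℝ] ℝ)
        (ContinuousLinearMap.prod (mfderiv (𝓡 n) 𝓘(ℝ, ℝ) q x : EuclideanSpace ℝ (Fin n) →L[ℝ] ℝ)
          (mfderiv (𝓡 n) 𝓘(ℝ, ℝ) w x : EuclideanSpace ℝ (Fin n) →L[ℝ] ℝ))) :=
    ⟨hu'.1.prodMk (hq'.1.prodMk hw'.1), hu'.2.prodMk (hq'.2.prodMk hw'.2)⟩
  have hΦ' : HasMFDerivAt 𝓘(ℝ, ℝ × ℝ × ℝ) 𝓘(ℝ, ℝ) Φ (u x, q x, w x) L := hΦ.hasMFDerivAt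
  have h2 := hΦ'.comp x h1
  have hL : ∀ a b c : ℝ, L (a, b, c) = L (1, 0, 0) * a + L (0, 1, 0) * b + L (0, 0, 1) * c := by
    intro a b c
    have : ((a, b, c) : ℝ × ℝ × ℝ) = a • (1, 0, 0) + b • (0, 1, 0) + c • (0, 0, 1) := by simp
    rw [this]
    simp only [map_add, map_smul, smul_eq_mul]
    ring
  ext k
  simp only [horizGrad]
  change (mfderiv (𝓡 n) 𝓘(ℝ, ℝ) (Φ ∘ fun y => (u y, q y, w y)) x) (X k x) = _
  rw [h2.mfderiv]
  exact hL _ _ _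

variable [IsManifold (𝓡 n) ∞ M]

/-- The derivative of a `C¹` map along a smooth vector field is continuous. -/
theorem continuousOn_mfderiv_vectorField {F : Type*} [NormedAddCommGroup F] [NormedSpace ℝ F]
    {Y : (x : M) → TangentSpace (𝓡 n) x}
    (hY : ContMDiff (𝓡 n) (𝓡 n).tangent ∞ (fun x => (⟨x, Y x⟩ : TangentBundle (𝓡 n) M)))
    {U : Set M} (hU : IsOpen U) {f : M → F} (hf : ContMDiffOn (𝓡 n) 𝓘(ℝ, F) 1 f U) :
    ContinuousOn (fun x => (mfderiv (𝓡 n) 𝓘(ℝ, F) f x (Y x) : F)) U := by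
  have : IsManifold (𝓡 n) 1 M := IsManifold.of_le (n := ∞) (by simp)
  have h1 := hf.continuousOn_tangentMapWithin le_rfl hU.uniqueMDiffOn
  have h2 : ContinuousOn (fun x => (tangentMapWithin (𝓡 n) 𝓘(ℝ, F) f U
      (⟨x, Y x⟩ : TangentBundle (𝓡 n) M))) U :=
    h1.comp hY.continuous.continuousOn fun x hx => hx
  have h3 := (contMDiff_snd_tangentBundle_modelSpace (n := 0) F
    𝓘(ℝ, F)).continuous.comp_continuousOn h2
  refine h3.congr fun x hx => ?_
  simp only [Function.comp, tangentMapWithin]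
  rw [mfderivWithin_of_isOpen hU hx]

theorem continuousOn_horizGrad
    (hX : ∀ k, ContMDiff (𝓡 n) (𝓡 n).tangent ∞
      (fun x => (⟨x, X k x⟩ : TangentBundle (𝓡 n) M)))
    {U : Set M} (hU : IsOpen U) {f : M → ℝ} (hf : ContMDiffOn (𝓡 n) 𝓘(ℝ, ℝ) 1 f U) :
    ContinuousOn (horizGrad X f) U := by
  have : ContinuousOn (fun x k => (mfderiv (𝓡 n) 𝓘(ℝ, ℝ) f x (X k x) : ℝ)) U :=
    continuousOn_pi.2 fun k => continuousOn_mfderiv_vectorField (hX k) hU hf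
  exact (PiLp.continuous_toLp 2 _).comp_continuousOn this

end Basic

/-! ### Smoothing of compactly supported `C¹` functions -/

section Smoothing

open Filter Topology

/-- Mollification of a nonnegative compactly supported `C¹` function: it is a `C¹`-limit of
nonnegative smooth functions with supports in one compact neighbourhood of its support. -/
theorem exists_contDiff_approx {E : Type*} [NormedAddCommGroup E] [NormedSpace ℝ E]
    [FiniteDimensional ℝ E] {Ψ : E → ℝ} (hΨ : ContDiff ℝ 1 Ψ) (hc : HasCompactSupport Ψ)
    (h0 : ∀ y, 0 ≤ Ψ y) {V : Set E} (hV : IsOpen V) (hsV : tsupport Ψ ⊆ V) :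
    ∃ L : Set E, IsCompact L ∧ L ⊆ V ∧ ∀ ε > 0, ∃ Φ : E → ℝ, ContDiff ℝ ∞ Φ ∧ (∀ y, 0 ≤ Φ y) ∧
      (∀ y ∉ L, Φ y = 0) ∧ ∀ y, |Φ y - Ψ y| ≤ ε ∧ ‖fderiv ℝ Φ y - fderiv ℝ Ψ y‖ ≤ ε := by
  borelize E
  obtain ⟨δ₀, hδ₀, hsub⟩ := hc.isCompact.exists_cthickening_subset_open hV hsV
  refine ⟨Metric.cthickening δ₀ (tsupport Ψ), hc.isCompact.cthickening, hsub, fun ε hε => ?_⟩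
  obtain ⟨δ₁, hδ₁, h1⟩ := Metric.uniformContinuous_iff.1
    (hc.uniformContinuous_of_continuous hΨ.continuous) ε hε
  have hdc : Continuous (fderiv ℝ Ψ) := hΨ.continuous_fderiv one_ne_zero
  obtain ⟨δ₂, hδ₂, h2⟩ := Metric.uniformContinuous_iff.1
    ((hc.fderiv ℝ).uniformContinuous_of_continuous hdc) ε hε
  set δ := min δ₀ (min δ₁ δ₂)
  have hδ : 0 < δ := lt_min hδ₀ (lt_min hδ₁ hδ₂)
  let b : ContDiffBump (0 : E) := ⟨δ / 2, δ, half_pos hδ, half_lt_self hδ⟩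
  let μ : Measure E := Measure.addHaar
  have hball : ∀ x y : E, y ∈ Metric.ball x b.rOut → dist y x < δ := fun x y h => h
  have hder : ∀ y, HasFDerivAt
      (convolution (b.normed μ) Ψ (ContinuousLinearMap.lsmul ℝ ℝ) μ)
      (convolution (b.normed μ) (fderiv ℝ Ψ) (ContinuousLinearMap.lsmul ℝ ℝ) μ y) y := by
    intro y
    have := hc.hasFDerivAt_convolution_right (μ := μ) (ContinuousLinearMap.lsmul ℝ ℝ)
      ((b.continuous_normed (μ := μ)).locallyIntegrable (μ := μ)) hΨ y
    have hL : (ContinuousLinearMap.lsmul ℝ ℝ : ℝ →L[ℝ] ℝ →L[ℝ] ℝ).precompR E =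
        (ContinuousLinearMap.lsmul ℝ ℝ : ℝ →L[ℝ] (E →L[ℝ] ℝ) →L[ℝ] (E →L[ℝ] ℝ)) := by
      ext
      simp [ContinuousLinearMap.precompR]
    rwa [hL] at this
  refine ⟨convolution (b.normed μ) Ψ (ContinuousLinearMap.lsmul ℝ ℝ) μ, ?_, ?_, ?_, ?_⟩
  · exact b.hasCompactSupport_normed.contDiff_convolution_left _ b.contDiff_normed
      (hΨ.continuous.locallyIntegrable)
  · intro y
    refine integral_nonneg fun t => ?_
    simp only [ContinuousLinearMap.lsmul_apply, smul_eq_mul]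
    exact mul_nonneg (b.nonneg_normed t) (h0 _)
  · intro y hy
    have hz : ∀ z ∈ Metric.ball y b.rOut, Ψ z = 0 := by
      intro z hz
      by_contra hne
      refine hy (Metric.mem_cthickening_of_dist_le y z δ₀ _ (subset_tsupport _ hne) ?_)
      rw [dist_comm]
      exact (hball _ _ hz).le.trans (min_le_left _ _)
    have hyy := hz y (Metric.mem_ball_self b.rOut_pos)
    rw [b.normed_convolution_eq_right fun z h => by rw [hz z h, hyy], hyy]
  · intro y
    constructor
    · rw [← Real.dist_eq]
      refine b.dist_normed_convolution_le hΨ.continuous.aestronglyMeasurable fun z hz => ?_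
      exact (h1 ((hball _ _ hz).trans_le ((min_le_right _ _).trans (min_le_left _ _)))).le
    · rw [(hder y).fderiv, ← dist_eq_norm]
      refine b.dist_normed_convolution_le hdc.aestronglyMeasurable fun z hz => ?_
      exact (h2 ((hball _ _ hz).trans_le ((min_le_right _ _).trans (min_le_right _ _)))).le

theorem EuclideanSpace.norm_le_sum_abs {ι : Type*} [Fintype ι] (v : EuclideanSpace ℝ ι) :
    ‖v‖ ≤ ∑ k, |v k| := by
  rw [EuclideanSpace.norm_eq, Real.sqrt_le_left (Finset.sum_nonneg fun _ _ => abs_nonneg _)]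
  exact Finset.sum_sq_le_sq_sum_of_nonneg fun _ _ => norm_nonneg _

/-- Extension by zero of a `Cᵏ` function on an open set vanishing off a closed subset. -/
theorem contMDiff_of_eq_zero_off_closed {H E F M : Type*} [NormedAddCommGroup E] [NormedSpace ℝ E]
    [TopologicalSpace H] {I : ModelWithCorners ℝ E H} [TopologicalSpace M] [ChartedSpace H M]
    [NormedAddCommGroup F] [NormedSpace ℝ F] {f : M → F} {k : WithTop ℕ∞}
    {U K : Set M} (hU : IsOpen U) (hK : IsClosed K) (hKU : K ⊆ U)
    (hf : ContMDiffOn I 𝓘(ℝ, F) k f U) (h0 : ∀ x ∉ K, f x = 0) :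
    ContMDiff I 𝓘(ℝ, F) k f := by
  intro x
  by_cases hx : x ∈ K
  · exact (hf x (hKU hx)).contMDiffAt (hU.mem_nhds (hKU hx))
  · refine contMDiffAt_const (c := (0 : F)) |>.congr_of_eventuallyEq ?_
    filter_upwards [hK.isOpen_compl.mem_nhds hx] with y hy using h0 y hy

variable {n N : ℕ} {M : Type*} [TopologicalSpace M] [ChartedSpace (EuclideanSpace ℝ (Fin n)) M]
  [IsManifold (𝓡 n) ∞ M] {X : Fin N → (x : M) → TangentSpace (𝓡 n) x}

/-- The case of a support in one chart: mollify in the chart. The horizontal gradients stay close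
because the coefficients of the vector fields are bounded on compact subsets of the chart. -/
theorem exists_test_approx_of_chart [T2Space M]
    (hX : ∀ k, ContMDiff (𝓡 n) (𝓡 n).tangent ∞
      (fun x => (⟨x, X k x⟩ : TangentBundle (𝓡 n) M)))
    {Ω : Set M} (hΩ : IsOpen Ω) {ψ : M → ℝ} (hψ : ContMDiff (𝓡 n) 𝓘(ℝ, ℝ) 1 ψ)
    (h0 : ∀ x, 0 ≤ ψ x) (hc : HasCompactSupport ψ) (hsΩ : tsupport ψ ⊆ Ω) (c : M)
    (hs : tsupport ψ ⊆ (chartAt (EuclideanSpace ℝ (Fin n)) c).source) :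
    ∃ K : Set M, IsCompact K ∧ K ⊆ Ω ∧ ∀ ε > 0, ∃ φ : M → ℝ,
      ContMDiff (𝓡 n) 𝓘(ℝ, ℝ) ∞ φ ∧ (∀ x, 0 ≤ φ x) ∧ (∀ x ∉ K, φ x = 0) ∧
      ∀ x, |φ x - ψ x| ≤ ε ∧ ‖horizGrad X φ x - horizGrad X ψ x‖ ≤ ε := by
  classical
  set e := chartAt (EuclideanSpace ℝ (Fin n)) c with he
  have he' : ContMDiffOn (𝓡 n) 𝓘(ℝ, EuclideanSpace ℝ (Fin n)) ∞ e e.source := contMDiffOn_chart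
  have hes : ContMDiffOn 𝓘(ℝ, EuclideanSpace ℝ (Fin n)) (𝓡 n) ∞ e.symm e.target :=
    contMDiffOn_chart_symm
  set Ψ : EuclideanSpace ℝ (Fin n) → ℝ := e.target.indicator (ψ ∘ e.symm) with hΨdef
  have hKc : IsCompact (e '' tsupport ψ) := hc.isCompact.image_of_continuousOn
    (e.continuousOn.mono hs)
  have hKt : e '' tsupport ψ ⊆ e.target := by
    rintro _ ⟨x, hx, rfl⟩
    exact e.map_source (hs hx)
  have hΨ0 : ∀ y ∉ e '' tsupport ψ, Ψ y = 0 := by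
    intro y hy
    by_cases ht : y ∈ e.target
    · rw [hΨdef, indicator_of_mem ht]
      by_contra hne
      exact hy ⟨e.symm y, subset_tsupport _ hne, e.right_inv ht⟩
    · exact indicator_of_notMem ht _
  have hΨ1 : ContDiff ℝ 1 Ψ := by
    rw [← contMDiff_iff_contDiff]
    refine contMDiff_of_eq_zero_off_closed e.open_target hKc.isClosed hKt ?_ hΨ0
    refine (hψ.comp_contMDiffOn (hes.of_le (by simp))).congr fun y hy => ?_
    rw [hΨdef, indicator_of_mem hy]
  have hΨs : tsupport Ψ ⊆ e '' tsupport ψ :=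
    closure_minimal (fun y hy => by_contra fun h => hy (hΨ0 y h)) hKc.isClosed
  have hV : IsOpen (e.target ∩ e.symm ⁻¹' Ω) := e.isOpen_inter_preimage_symm hΩ
  have hsV : tsupport Ψ ⊆ e.target ∩ e.symm ⁻¹' Ω := by
    intro y hy
    obtain ⟨x, hx, rfl⟩ := hΨs hy
    refine ⟨e.map_source (hs hx), ?_⟩
    rw [mem_preimage, e.left_inv (hs hx)]
    exact hsΩ hx
  have hΨe : ∀ x ∈ e.source, Ψ (e x) = ψ x := fun x hx => by
    rw [hΨdef, indicator_of_mem (e.map_source hx), Function.comp, e.left_inv hx]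
  obtain ⟨L, hLc, hLV, hL⟩ := exists_contDiff_approx hΨ1
    (hKc.of_isClosed_subset (isClosed_tsupport _) hΨs) (fun y => by
      rw [hΨdef]; exact indicator_nonneg (fun y _ => h0 _) y) hV hsV
  have hK1c : IsCompact (e.symm '' L) := hLc.image_of_continuousOn
    (e.symm.continuousOn.mono fun y hy => (hLV hy).1)
  have hK1s : e.symm '' L ⊆ e.source := by
    rintro _ ⟨y, hy, rfl⟩
    exact e.map_target (hLV hy).1
  set K := e.symm '' L ∪ tsupport ψ
  have hKcomp : IsCompact K := hK1c.union hc.isCompact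
  have hKs : K ⊆ e.source := union_subset hK1s hs
  -- the components of the vector fields in the chart are bounded on `K`
  set m : Fin N → M → EuclideanSpace ℝ (Fin n) := fun k x =>
    mfderiv (𝓡 n) 𝓘(ℝ, EuclideanSpace ℝ (Fin n)) e x (X k x)
  have hmc : ContinuousOn (fun x => ∑ k, ‖m k x‖) K :=
    continuousOn_finsetSum _ fun k _ => ((continuousOn_mfderiv_vectorField (hX k) e.open_source
      (he'.of_le (by simp))).mono hKs).norm
  obtain ⟨C, hC⟩ := (hKcomp.image_of_continuousOn hmc).bddAbove
  have hC' : ∀ x ∈ K, ∑ k, ‖m k x‖ ≤ max C 0 := fun x hx =>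
    (hC (mem_image_of_mem _ hx)).trans (le_max_left _ _)
  refine ⟨K, hKcomp, union_subset ?_ hsΩ, fun ε hε => ?_⟩
  · rintro _ ⟨y, hy, rfl⟩
    exact (hLV hy).2
  have hCpos : 0 < max C 0 + 1 := by positivity
  obtain ⟨Φ, hΦ1, hΦ0, hΦL, hΦ⟩ := hL (min ε (ε / (max C 0 + 1))) (by positivity)
  set φ : M → ℝ := e.source.indicator (Φ ∘ e) with hφdef
  have hφK : ∀ x ∉ K, φ x = 0 := by
    intro x hx
    by_cases hxs : x ∈ e.source
    · rw [hφdef, indicator_of_mem hxs]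
      refine hΦL _ fun hL => hx (Or.inl ⟨e x, hL, e.left_inv hxs⟩)
    · exact indicator_of_notMem hxs _
  have hφe : ∀ x ∈ e.source, φ x = Φ (e x) := fun x hx => indicator_of_mem hx _
  have hψK : ∀ x ∉ K, ψ x = 0 := fun x hx => by
    by_contra hne
    exact hx (Or.inr (subset_tsupport _ hne))
  refine ⟨φ, ?_, indicator_nonneg (fun x _ => hΦ0 _), hφK, fun x => ?_⟩
  · refine contMDiff_of_eq_zero_off_closed e.open_source hKcomp.isClosed hKs ?_ hφK
    exact (hΦ1.contMDiff.comp_contMDiffOn he').congr hφe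
  by_cases hx : x ∈ K
  · have hxs := hKs hx
    have hnhds := e.open_source.mem_nhds hxs
    constructor
    · rw [hφe x hxs, ← hΨe x hxs]
      exact (hΦ _).1.trans (min_le_left _ _)
    · have hed : MDifferentiableAt (𝓡 n) 𝓘(ℝ, EuclideanSpace ℝ (Fin n)) e x :=
        ((he' x hxs).contMDiffAt hnhds).mdifferentiableAt (by simp)
      have key : ∀ (f : M → ℝ) (F : EuclideanSpace ℝ (Fin n) → ℝ), DifferentiableAt ℝ F (e x) →
          (∀ y ∈ e.source, f y = F (e y)) → ∀ k, horizGrad X f x k = fderiv ℝ F (e x) (m k x) := by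
        intro f F hF hfF k
        have h1 : f =ᶠ[𝓝 x] F ∘ e := by
          filter_upwards [hnhds] with y hy using hfF y hy
        rw [horizGrad_congr h1]
        have hF' : HasMFDerivAt 𝓘(ℝ, EuclideanSpace ℝ (Fin n)) 𝓘(ℝ, ℝ) F (e x)
          (fderiv ℝ F (e x)) := hF.hasFDerivAt.hasMFDerivAt
        simp only [horizGrad, (hF'.comp x hed.hasMFDerivAt).mfderiv]
        rfl
      have hk := fun k => key φ Φ (hΦ1.differentiable (by simp) _) hφe k
      have hk' := fun k => key ψ Ψ (hΨ1.differentiable (by simp) _) (fun y hy => (hΨe y hy).symm) k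
      calc ‖horizGrad X φ x - horizGrad X ψ x‖
          ≤ ∑ k, |(horizGrad X φ x - horizGrad X ψ x) k| := EuclideanSpace.norm_le_sum_abs _
        _ ≤ ∑ k, ε / (max C 0 + 1) * ‖m k x‖ := by
            refine Finset.sum_le_sum fun k _ => ?_
            rw [PiLp.sub_apply, hk k, hk' k, ← sub_apply, ← Real.norm_eq_abs]
            exact ContinuousLinearMap.le_of_opNorm_le _
              ((hΦ _).2.trans (min_le_right _ _)) _
        _ ≤ ε / (max C 0 + 1) * (max C 0 + 1) := by
            rw [← Finset.mul_sum]
            have := hC' x hx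
            gcongr
            linarith
        _ = ε := by field_simp
  · have hnhds := hKcomp.isClosed.isOpen_compl.mem_nhds hx
    rw [hφK x hx, hψK x hx, horizGrad_eq_zero (f := φ) (by
      filter_upwards [hnhds] with y hy using hφK y hy), horizGrad_eq_zero (f := ψ) (by
      filter_upwards [hnhds] with y hy using hψK y hy)]
    simpa using hε.le

/-- A nonnegative compactly supported `C¹` function is a `C¹`-limit, along the horizontal
directions, of nonnegative test functions with supports in one compact set. -/
theorem exists_test_approx [T2Space M] [SecondCountableTopology M]
    (hX : ∀ k, ContMDiff (𝓡 n) (𝓡 n).tangent ∞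
      (fun x => (⟨x, X k x⟩ : TangentBundle (𝓡 n) M)))
    {Ω : Set M} (hΩ : IsOpen Ω) {ψ : M → ℝ} (hψ : ContMDiff (𝓡 n) 𝓘(ℝ, ℝ) 1 ψ)
    (h0 : ∀ x, 0 ≤ ψ x) (hc : HasCompactSupport ψ) (hsΩ : tsupport ψ ⊆ Ω) :
    ∃ K : Set M, IsCompact K ∧ K ⊆ Ω ∧ ∀ ε > 0, ∃ φ : M → ℝ,
      ContMDiff (𝓡 n) 𝓘(ℝ, ℝ) ∞ φ ∧ (∀ x, 0 ≤ φ x) ∧ (∀ x ∉ K, φ x = 0) ∧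
      ∀ x, |φ x - ψ x| ≤ ε ∧ ‖horizGrad X φ x - horizGrad X ψ x‖ ≤ ε := by
  classical
  have : LocallyCompactSpace M := Manifold.locallyCompact_of_finiteDimensional (𝓡 n)
  have : SigmaCompactSpace M := sigmaCompactSpace_of_locallyCompact_secondCountable
  obtain ⟨ρ, hρ⟩ := SmoothPartitionOfUnity.exists_isSubordinate (𝓡 n) (isClosed_tsupport ψ)
    (fun c : M => (chartAt (EuclideanSpace ℝ (Fin n)) c).source) (fun c => (chartAt _ c).open_source)
    (fun x _ => mem_iUnion.2 ⟨x, mem_chart_source _ x⟩)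
  have hfin := ρ.locallyFinite.finite_nonempty_inter_compact hc.isCompact
  obtain ⟨s, hs⟩ : ∃ s : Finset M, ∀ i, (Function.support (ρ i) ∩ tsupport ψ).Nonempty → i ∈ s :=
    ⟨hfin.toFinset, fun i hi => hfin.mem_toFinset.2 hi⟩
  set ψi : M → M → ℝ := fun i x => ρ i x * ψ x
  have hρ1 : ∀ i, ContMDiff (𝓡 n) 𝓘(ℝ, ℝ) 1 (ρ i) := fun i => (ρ i).contMDiff.of_le (by simp)
  have hψi : ∀ i, ContMDiff (𝓡 n) 𝓘(ℝ, ℝ) 1 (ψi i) := fun i => (hρ1 i).mul hψ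
  have hsum : ψ = fun x => ∑ i ∈ s, ψi i x := by
    ext x
    by_cases hx : x ∈ tsupport ψ
    · rw [← Finset.sum_mul, ρ.sum_finsupport' x hx, one_mul]
      intro i hi
      rw [ρ.mem_finsupport] at hi
      exact hs i ⟨x, hi, hx⟩
    · have : ψ x = 0 := by
        by_contra h
        exact hx (subset_tsupport _ h)
      simp [ψi, this]
  have hts : ∀ i, tsupport (ψi i) ⊆ tsupport ψ := fun i => tsupport_mul_subset_right
  have hloc : ∀ i, ∃ K : Set M, IsCompact K ∧ K ⊆ Ω ∧ ∀ ε > 0, ∃ φ : M → ℝ,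
      ContMDiff (𝓡 n) 𝓘(ℝ, ℝ) ∞ φ ∧ (∀ x, 0 ≤ φ x) ∧ (∀ x ∉ K, φ x = 0) ∧
      ∀ x, |φ x - ψi i x| ≤ ε ∧ ‖horizGrad X φ x - horizGrad X (ψi i) x‖ ≤ ε := fun i =>
    exists_test_approx_of_chart hX hΩ (hψi i) (fun x => mul_nonneg (ρ.nonneg i x) (h0 x))
      (hc.isCompact.of_isClosed_subset (isClosed_tsupport _) (hts i)) ((hts i).trans hsΩ) i
      ((tsupport_mul_subset_left).trans (hρ i))
  choose K hKc hKΩ hK using hloc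
  refine ⟨⋃ i ∈ s, K i, s.isCompact_biUnion fun i _ => hKc i,
    iUnion₂_subset fun i _ => hKΩ i, fun ε hε => ?_⟩
  have hcard : (0 : ℝ) < (s.card : ℝ) + 1 := Nat.cast_add_one_pos _
  choose φ hφ1 hφ0 hφK hφ using fun i => hK i (ε / ((s.card : ℝ) + 1)) (div_pos hε hcard)
  have hle : ∑ _i ∈ s, ε / ((s.card : ℝ) + 1) ≤ ε := by
    rw [Finset.sum_const, nsmul_eq_mul, mul_div_assoc', div_le_iff₀ hcard, mul_comm]
    exact mul_le_mul_of_nonneg_left (le_add_of_nonneg_right zero_le_one) hε.le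
  refine ⟨fun x => ∑ i ∈ s, φ i x, contMDiff_finsetSum fun i _ => hφ1 i,
    fun x => Finset.sum_nonneg fun i _ => hφ0 i x, fun x hx => Finset.sum_eq_zero fun i hi => ?_,
    fun x => ⟨?_, ?_⟩⟩
  · exact hφK i x fun h => hx (mem_biUnion hi h)
  · rw [hsum, ← Finset.sum_sub_distrib]
    exact (Finset.abs_sum_le_sum_abs _ _).trans
      ((Finset.sum_le_sum fun i _ => (hφ i x).1).trans hle)
  · conv_lhs => rw [hsum]
    rw [(horizGrad_sum fun i _ => ((hφ1 i).mdifferentiable (by simp)) x).2,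
      (horizGrad_sum fun i _ => ((hψi i).mdifferentiable (by simp)) x).2,
      ← Finset.sum_sub_distrib]
    exact (norm_sum_le _ _).trans ((Finset.sum_le_sum fun i _ => (hφ i x).2).trans hle)

end Smoothing

/-! ### The weak inequality for `C¹` test functions -/

section Form

open Filter Topology

section General

variable {V : Type*} [NormedAddCommGroup V] [InnerProductSpace ℝ V]

theorem abs_rpow_mul_inner_le (G D : V) (p : ℝ) :
    |‖G‖ ^ (p - 2) * inner ℝ G D| ≤ ‖G‖ ^ (p - 1) * ‖D‖ := by
  rcases eq_or_ne G 0 with rfl | hG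
  · simp only [inner_zero_left, mul_zero, abs_zero]
    positivity
  · have hG' : 0 < ‖G‖ := norm_pos_iff.2 hG
    rw [abs_mul, abs_of_nonneg (by positivity : 0 ≤ ‖G‖ ^ (p - 2))]
    calc ‖G‖ ^ (p - 2) * |inner ℝ G D| ≤ ‖G‖ ^ (p - 2) * (‖G‖ * ‖D‖) := by
          gcongr
          exact abs_real_inner_le_norm G D
      _ = ‖G‖ ^ (p - 1) * ‖D‖ := by
          rw [← mul_assoc, ← Real.rpow_add_one hG'.ne']
          ring_nf

variable {α : Type*} [MeasurableSpace α] {μ : Measure α} {p : α → ℝ} {G D : α → V}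

theorem aestronglyMeasurable_form (hp : AEMeasurable p μ) (hG : AEStronglyMeasurable G μ)
    (hD : AEStronglyMeasurable D μ) :
    AEStronglyMeasurable (fun x => ‖G x‖ ^ (p x - 2) * inner ℝ (G x) (D x)) μ :=
  ((hG.norm.aemeasurable.pow (hp.sub_const 2)).aestronglyMeasurable).mul (hG.inner hD)

theorem integrable_form (hp : AEMeasurable p μ) (hG : AEStronglyMeasurable G μ)
    (hD : AEStronglyMeasurable D μ) (h : Integrable (fun x => ‖G x‖ ^ (p x - 1) * ‖D x‖) μ) :
    Integrable (fun x => ‖G x‖ ^ (p x - 2) * inner ℝ (G x) (D x)) μ :=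
  h.mono' (aestronglyMeasurable_form hp hG hD)
    (Eventually.of_forall fun _ => abs_rpow_mul_inner_le _ _ _)

theorem integrable_form_of_bounded (hp : AEMeasurable p μ) (hG : AEStronglyMeasurable G μ)
    (hGi : Integrable (fun x => ‖G x‖ ^ (p x - 1)) μ)
    (hD : AEStronglyMeasurable D μ) {C : ℝ} (hC : ∀ᵐ x ∂μ, ‖D x‖ ≤ C) :
    Integrable (fun x => ‖G x‖ ^ (p x - 2) * inner ℝ (G x) (D x)) μ :=
  integrable_form hp hG hD (hGi.mul_bdd hD.norm (by simpa using hC))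

end General

theorem exists_bound_of_continuous_of_eq_zero {M F : Type*} [TopologicalSpace M]
    [NormedAddCommGroup F] {f : M → F} {K : Set M} (hK : IsCompact K) (hf : ContinuousOn f K)
    (h0 : ∀ x ∉ K, f x = 0) : ∃ C, ∀ x, ‖f x‖ ≤ C := by
  obtain ⟨C, hC⟩ := hK.exists_bound_of_continuousOn hf
  refine ⟨max C 0, fun x => ?_⟩
  by_cases hx : x ∈ K
  · exact (hC x hx).trans (le_max_left _ _)
  · simp [h0 x hx]

theorem integrable_mul_of_eq_zero_off_compact {M : Type*} [TopologicalSpace M] [T2Space M]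
    [SecondCountableTopology M] [MeasurableSpace M] [BorelSpace M] {μ : Measure M} {Ω K : Set M}
    {w f : M → ℝ} (hK : IsCompact K) (hw : IntegrableOn w K μ) (hf : Continuous f)
    (hf0 : ∀ x ∉ K, f x = 0) : Integrable (fun x => w x * f x) (μ.restrict Ω) := by
  obtain ⟨C, hC⟩ := exists_bound_of_continuous_of_eq_zero hK hf.continuousOn hf0
  have h1 : IntegrableOn (fun x => w x * f x) K μ :=
    Integrable.mul_bdd hw hf.aestronglyMeasurable (Eventually.of_forall hC)
  exact (h1.integrable_of_forall_notMem_eq_zero fun x hx => by simp [hf0 x hx]).restrict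

variable {n N : ℕ} {M : Type*} [TopologicalSpace M] [ChartedSpace (EuclideanSpace ℝ (Fin n)) M]
  [IsManifold (𝓡 n) ∞ M] {X : Fin N → (x : M) → TangentSpace (𝓡 n) x}

theorem continuous_horizGrad
    (hX : ∀ k, ContMDiff (𝓡 n) (𝓡 n).tangent ∞
      (fun x => (⟨x, X k x⟩ : TangentBundle (𝓡 n) M)))
    {f : M → ℝ} (hf : ContMDiff (𝓡 n) 𝓘(ℝ, ℝ) 1 f) : Continuous (horizGrad X f) :=
  continuousOn_univ.1 (continuousOn_horizGrad hX isOpen_univ hf.contMDiffOn)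

theorem exists_bound_horizGrad
    (hX : ∀ k, ContMDiff (𝓡 n) (𝓡 n).tangent ∞
      (fun x => (⟨x, X k x⟩ : TangentBundle (𝓡 n) M)))
    {f : M → ℝ} (hf : ContMDiff (𝓡 n) 𝓘(ℝ, ℝ) 1 f) (hc : HasCompactSupport f) :
    ∃ C, ∀ x, ‖horizGrad X f x‖ ≤ C :=
  exists_bound_of_continuous_of_eq_zero hc.isCompact (continuous_horizGrad hX hf).continuousOn
    fun _ hx => horizGrad_eq_zero (notMem_tsupport_iff_eventuallyEq.1 hx)

variable [T2Space M] [SecondCountableTopology M] [MeasurableSpace M] [BorelSpace M]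

/-- A weak inequality tested with smooth functions holds for `C¹` functions as well, as long as
`|G|^{p-1}` is integrable and the weight `w` is integrable on compact sets. -/
theorem weak_ineq_of_contMDiff_one {vol : SmoothVolume n M}
    (hX : ∀ k, ContMDiff (𝓡 n) (𝓡 n).tangent ∞
      (fun x => (⟨x, X k x⟩ : TangentBundle (𝓡 n) M)))
    {Ω : Set M} (hΩ : IsOpen Ω) {p : M → ℝ} (hp : AEMeasurable p (vol.measure.restrict Ω))
    {G : M → EuclideanSpace ℝ (Fin N)} (hG : AEStronglyMeasurable G (vol.measure.restrict Ω))
    (hGi : Integrable (fun x => ‖G x‖ ^ (p x - 1)) (vol.measure.restrict Ω))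
    {w : M → ℝ} (hw : ∀ K ⊆ Ω, IsCompact K → IntegrableOn w K vol.measure)
    (h : ∀ φ : M → ℝ, IsTestFunction (n := n) Ω φ → (∀ x, 0 ≤ φ x) →
      ∫ x in Ω, w x * φ x ∂vol.measure ≤ pSubLaplaceForm X vol Ω p G φ)
    {ψ : M → ℝ} (hψ : ContMDiff (𝓡 n) 𝓘(ℝ, ℝ) 1 ψ) (h0 : ∀ x, 0 ≤ ψ x)
    (hc : HasCompactSupport ψ) (hsΩ : tsupport ψ ⊆ Ω) :
    ∫ x in Ω, w x * ψ x ∂vol.measure ≤ pSubLaplaceForm X vol Ω p G ψ := by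
  obtain ⟨K₀, hK₀, hK₀Ω, happ⟩ := exists_test_approx hX hΩ hψ h0 hc hsΩ
  set K := K₀ ∪ tsupport ψ
  have hK : IsCompact K := hK₀.union hc.isCompact
  have hKΩ : K ⊆ Ω := union_subset hK₀Ω hsΩ
  have hψK : ∀ x ∉ K, ψ x = 0 := fun x hx => by
    by_contra hne
    exact hx (Or.inr (subset_tsupport _ hne))
  set μ := vol.measure.restrict Ω
  have hwK : Integrable (K.indicator fun x => |w x|) μ :=
    ((integrable_indicator_iff hK.measurableSet).2 (hw K hKΩ hK).abs).restrict
  have hint : ∀ f : M → ℝ, Continuous f → (∀ x ∉ K, f x = 0) →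
      Integrable (fun x => w x * f x) μ := fun f hf hf0 =>
    integrable_mul_of_eq_zero_off_compact hK (hw K hKΩ hK) hf hf0
  have hform : ∀ f : M → ℝ, ContMDiff (𝓡 n) 𝓘(ℝ, ℝ) 1 f → HasCompactSupport f →
      Integrable (fun x => ‖G x‖ ^ (p x - 2) * inner ℝ (G x) (horizGrad X f x)) μ := by
    intro f hf hfc
    obtain ⟨C, hC⟩ := exists_bound_horizGrad hX hf hfc
    exact integrable_form_of_bounded hp hG hGi (continuous_horizGrad hX hf).aestronglyMeasurable
      (Eventually.of_forall hC)
  set C := ∫ x, K.indicator (fun x => |w x|) x ∂μ + ∫ x, ‖G x‖ ^ (p x - 1) ∂μ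
  have hmain : ∀ ε > 0, ∫ x, w x * ψ x ∂μ ≤ pSubLaplaceForm X vol Ω p G ψ + ε * C := by
    intro ε hε
    obtain ⟨φ, hφ, hφ0, hφK, hφε⟩ := happ ε hε
    have hφK' : ∀ x ∉ K, φ x = 0 := fun x hx => hφK x fun h => hx (Or.inl h)
    have hφs : tsupport φ ⊆ K₀ :=
      closure_minimal (fun x hx => by_contra fun h => hx (hφK x h)) hK₀.isClosed
    have hφc : HasCompactSupport φ := hK₀.of_isClosed_subset (isClosed_tsupport _) hφs
    have hφ1 : ContMDiff (𝓡 n) 𝓘(ℝ, ℝ) 1 φ := hφ.of_le (by simp)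
    have h1 := h φ ⟨hφ, hφc, hφs.trans hK₀Ω⟩ hφ0
    have h2 : ∫ x, w x * ψ x ∂μ - ∫ x, w x * φ x ∂μ ≤
        ε * ∫ x, K.indicator (fun x => |w x|) x ∂μ := by
      rw [← integral_sub (hint ψ hψ.continuous hψK) (hint φ hφ.continuous hφK'),
        ← integral_const_mul]
      refine integral_mono ((hint ψ hψ.continuous hψK).sub (hint φ hφ.continuous hφK'))
        (hwK.const_mul ε) fun x => ?_
      by_cases hx : x ∈ K
      · simp only [indicator_of_mem hx]
        calc w x * ψ x - w x * φ x ≤ |w x * (φ x - ψ x)| := by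
              rw [← abs_neg]
              exact (le_of_eq (by ring)).trans (le_abs_self _)
          _ = |w x| * |φ x - ψ x| := abs_mul _ _
          _ ≤ |w x| * ε := by gcongr; exact (hφε x).1
          _ = ε * |w x| := mul_comm _ _
      · simp [indicator_of_notMem hx, hψK x hx, hφK' x hx]
    have h3 : pSubLaplaceForm X vol Ω p G φ - pSubLaplaceForm X vol Ω p G ψ ≤
        ε * ∫ x, ‖G x‖ ^ (p x - 1) ∂μ := by
      simp only [pSubLaplaceForm]
      rw [← integral_sub (hform φ hφ1 hφc) (hform ψ hψ hc), ← integral_const_mul]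
      refine integral_mono ((hform φ hφ1 hφc).sub (hform ψ hψ hc)) (hGi.const_mul ε) fun x => ?_
      simp only
      rw [← mul_sub, ← inner_sub_right, mul_comm ε]
      refine (le_abs_self _).trans ((abs_rpow_mul_inner_le _ _ _).trans ?_)
      gcongr
      exact (hφε x).2
    simp only [C, mul_add]
    linarith
  refine le_of_forall_pos_le_add fun δ hδ => ?_
  have hC0 : 0 ≤ C := add_nonneg
    (integral_nonneg fun x => indicator_nonneg (fun _ _ => abs_nonneg _) x)
    (integral_nonneg fun x => by positivity)
  refine (hmain (δ / (C + 1)) (by positivity)).trans ?_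
  gcongr
  rw [div_mul_eq_mul_div, div_le_iff₀ (by positivity)]
  nlinarith

end Form

/-! ### The Picone test function `|u|^p / F(p, V)` -/

section Picone

open Filter Topology

theorem continuousAt_abs_rpow_mul_self {z : ℝ × ℝ} (hz : 1 < z.2) :
    ContinuousAt (fun z : ℝ × ℝ => |z.1| ^ (z.2 - 2) * z.1) z := by
  -- positive and negative parts avoid the possibly negative exponent
  have h : (fun z : ℝ × ℝ => |z.1| ^ (z.2 - 2) * z.1) =ᶠ[𝓝 z]
      fun z => (max z.1 0) ^ (z.2 - 1) - (max (-z.1) 0) ^ (z.2 - 1) := by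
    filter_upwards [(isOpen_lt continuous_const continuous_snd).mem_nhds hz] with y hy
    have hy' : y.2 - 1 ≠ 0 := (sub_pos.2 hy).ne'
    have key : ∀ t : ℝ, 0 < t → t ^ (y.2 - 1) = t ^ (y.2 - 2) * t := fun t ht => by
      rw [← Real.rpow_add_one ht.ne']
      ring_nf
    rcases lt_trichotomy y.1 0 with h | h | h
    · rw [abs_of_neg h, max_eq_right h.le, max_eq_left (by linarith), Real.zero_rpow hy',
        key _ (by linarith)]
      ring
    · simp [h, Real.zero_rpow hy']
    · rw [abs_of_pos h, max_eq_left h.le, max_eq_right (by linarith), Real.zero_rpow hy',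
        key _ h]
      ring
  refine ContinuousAt.congr ?_ h.symm
  have hz' : 0 < z.2 - 1 := sub_pos.2 hz
  exact ((continuousAt_fst.max continuousAt_const).rpow (continuousAt_snd.sub continuousAt_const)
    (Or.inr hz')).sub ((continuousAt_fst.neg.max continuousAt_const).rpow
    (continuousAt_snd.sub continuousAt_const) (Or.inr hz'))

theorem continuousAt_abs_rpow_mul_log {z : ℝ × ℝ} (hz : 1 < z.2) :
    ContinuousAt (fun z : ℝ × ℝ => |z.1| ^ z.2 * Real.log |z.1|) z := by
  have h : (fun z : ℝ × ℝ => |z.1| ^ z.2 * Real.log |z.1|) =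
      fun z => |z.1| ^ (z.2 - 1) * (|z.1| * Real.log |z.1|) := by
    ext y
    rcases eq_or_ne y.1 0 with h | h
    · simp [h]
    · rw [← mul_assoc, ← Real.rpow_add_one (abs_pos.2 h).ne']
      ring_nf
  rw [h]
  exact (continuousAt_fst.abs.rpow (continuousAt_snd.sub continuousAt_const)
    (Or.inr (sub_pos.2 hz))).mul
    (Real.continuous_mul_log.continuousAt.comp (f := fun z : ℝ × ℝ => |z.1|) continuousAt_fst.abs)

theorem hasFDerivAt_abs_rpow {s q : ℝ} (hq : 1 < q) :
    HasFDerivAt (fun z : ℝ × ℝ => |z.1| ^ z.2)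
      ((q * (|s| ^ (q - 2) * s)) • ContinuousLinearMap.fst ℝ ℝ ℝ +
        (|s| ^ q * Real.log |s|) • ContinuousLinearMap.snd ℝ ℝ ℝ) (s, q) := by
  rcases eq_or_ne s 0 with rfl | hs
  · have hL : ((q * (|(0 : ℝ)| ^ (q - 2) * 0)) • ContinuousLinearMap.fst ℝ ℝ ℝ +
        (|(0 : ℝ)| ^ q * Real.log |(0 : ℝ)|) • ContinuousLinearMap.snd ℝ ℝ ℝ) = 0 := by simp
    rw [hL, hasFDerivAt_iff_isLittleO]
    have h1 : (fun z : ℝ × ℝ => |z.1| * |z.1| ^ (z.2 - 1)) =ᶠ[𝓝 ((0 : ℝ), q)]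
        fun z => |z.1| ^ z.2 - |(0 : ℝ)| ^ q - (0 : ℝ × ℝ →L[ℝ] ℝ) (z - (0, q)) := by
      filter_upwards [(isOpen_lt continuous_const continuous_snd).mem_nhds
        (show (1 : ℝ) < ((0 : ℝ), q).2 from hq)] with y hy
      rcases eq_or_ne y.1 0 with h | h
      · have : y.2 ≠ 0 := (zero_lt_one.trans hy).ne'
        simp [h, Real.zero_rpow this, Real.zero_rpow (zero_lt_one.trans hq).ne']
      · rw [mul_comm, ← Real.rpow_add_one (abs_pos.2 h).ne']
        simp [Real.zero_rpow (zero_lt_one.trans hq).ne']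
    refine Asymptotics.IsLittleO.congr' ?_ h1 EventuallyEq.rfl
    have h2 : (fun z : ℝ × ℝ => |z.1|) =O[𝓝 ((0 : ℝ), q)] fun z => z - (0, q) := by
      refine Asymptotics.IsBigO.of_bound 1 (Eventually.of_forall fun z => ?_)
      have := norm_fst_le (z - (0, q))
      simpa using this
    have h3 : (fun z : ℝ × ℝ => |z.1| ^ (z.2 - 1)) =o[𝓝 ((0 : ℝ), q)] fun _ => (1 : ℝ) := by
      rw [Asymptotics.isLittleO_one_iff]
      have : ContinuousAt (fun z : ℝ × ℝ => |z.1| ^ (z.2 - 1)) ((0 : ℝ), q) :=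
        continuousAt_fst.abs.rpow (continuousAt_snd.sub continuousAt_const)
          (Or.inr (sub_pos.2 hq))
      simpa [ContinuousAt, Real.zero_rpow (sub_pos.2 hq).ne'] using this
    have h4 := h2.norm_right.mul_isLittleO h3
    simpa using h4
  · have hs' : 0 < |s| := abs_pos.2 hs
    have h1 : HasFDerivAt (fun z : ℝ × ℝ => (|z.1|, z.2))
        ((((SignType.sign s : SignType) : ℝ) • ContinuousLinearMap.fst ℝ ℝ ℝ).prod
          (ContinuousLinearMap.snd ℝ ℝ ℝ)) (s, q) :=
      (HasDerivAt.comp_hasFDerivAt (h₂ := fun t : ℝ => |t|) (f := Prod.fst) (s, q)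
        (hasDerivAt_abs hs) hasFDerivAt_fst).prodMk hasFDerivAt_snd
    have h2 := (Real.hasStrictFDerivAt_rpow_of_pos (|s|, q) hs').hasFDerivAt.comp (s, q) h1
    refine h2.congr_fderiv ?_
    have hsign : |s| ^ (q - 1) * ((SignType.sign s : SignType) : ℝ) = |s| ^ (q - 2) * s := by
      have : |s| ^ (q - 1) = |s| ^ (q - 2) * |s| := by
        rw [← Real.rpow_add_one hs'.ne']
        ring_nf
      rw [this, mul_assoc, abs_mul_sign]
    ext
    · simp only [ContinuousLinearMap.comp_apply, ContinuousLinearMap.inl_apply]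
      simp [mul_assoc, hsign]
    · simp

theorem contDiffAt_abs_rpow {z : ℝ × ℝ} (hz : 1 < z.2) :
    ContDiffAt ℝ 1 (fun z : ℝ × ℝ => |z.1| ^ z.2) z := by
  rw [contDiffAt_one_iff]
  refine ⟨fun z => (z.2 * (|z.1| ^ (z.2 - 2) * z.1)) • ContinuousLinearMap.fst ℝ ℝ ℝ +
        (|z.1| ^ z.2 * Real.log |z.1|) • ContinuousLinearMap.snd ℝ ℝ ℝ, {z | 1 < z.2},
    (isOpen_lt continuous_const continuous_snd).mem_nhds hz, fun y hy => ?_,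
    fun y hy => hasFDerivAt_abs_rpow hy⟩
  refine ContinuousAt.continuousWithinAt ?_
  exact ((continuousAt_snd.mul (continuousAt_abs_rpow_mul_self hy)).smul continuousAt_const).add
    ((continuousAt_abs_rpow_mul_log hy).smul continuousAt_const)

/-- The derivative of `|s|^q / F(q, y)`; its `q`-component is not needed. -/
theorem hasFDerivAt_abs_rpow_div {F : ℝ × ℝ → ℝ} {L : ℝ × ℝ →L[ℝ] ℝ} {s q y : ℝ} (hq : 1 < q)
    (hF : HasFDerivAt F L (q, y)) (hpos : 0 < F (q, y)) :
    ∃ L' : ℝ × ℝ × ℝ →L[ℝ] ℝ,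
      HasFDerivAt (fun z : ℝ × ℝ × ℝ => |z.1| ^ z.2.1 / F z.2) L' (s, q, y) ∧
      L' (1, 0, 0) = q * (|s| ^ (q - 2) * s) / F (q, y) ∧
      L' (0, 0, 1) = -(|s| ^ q * L (0, 1) / F (q, y) ^ 2) := by
  have h1 : HasFDerivAt (fun z : ℝ × ℝ × ℝ => (z.1, z.2.1))
      ((ContinuousLinearMap.fst ℝ ℝ (ℝ × ℝ)).prod ((ContinuousLinearMap.fst ℝ ℝ ℝ).comp
        (ContinuousLinearMap.snd ℝ ℝ (ℝ × ℝ)))) (s, q, y) :=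
    hasFDerivAt_fst.prodMk (hasFDerivAt_fst.comp (s, q, y) hasFDerivAt_snd)
  have h2 := (hasFDerivAt_abs_rpow (s := s) hq).comp (s, q, y) h1
  have h3 : HasFDerivAt (fun z : ℝ × ℝ × ℝ => F z.2)
      (L.comp (ContinuousLinearMap.snd ℝ ℝ (ℝ × ℝ))) (s, q, y) :=
    hF.comp (s, q, y) hasFDerivAt_snd
  have h4 := (hasDerivAt_inv hpos.ne').comp_hasFDerivAt (s, q, y) h3
  refine ⟨_, h2.mul h4, ?_, ?_⟩
  · have : L (0, 0) = 0 := L.map_zero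
    simp [this]
    field_simp
  · simp
    field_simp

/-- The function `|u|^p / F(p, V)` on `Ω`, extended by zero. -/
noncomputable def piconeTest {M : Type*} (Ω : Set M) (p : M → ℝ) (F : ℝ × ℝ → ℝ)
    (u V : M → ℝ) : M → ℝ :=
  Ω.indicator fun x => |u x| ^ p x / F (p x, V x)

section Regularity

variable {M : Type*} {Ω : Set M} {p u V : M → ℝ} {F : ℝ × ℝ → ℝ}

theorem piconeTest_nonneg (hF0 : ∀ x ∈ Ω, 0 < F (p x, V x)) (x : M) :
    0 ≤ piconeTest Ω p F u V x :=
  indicator_nonneg (fun x hx => div_nonneg (by positivity) (hF0 x hx).le) x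

theorem piconeTest_eq_zero (hp1 : ∀ x ∈ Ω, 1 < p x) {K : Set M} (hu0 : ∀ x ∈ Ω, x ∉ K → u x = 0)
    {x : M} (hx : x ∉ K) : piconeTest Ω p F u V x = 0 := by
  by_cases hxΩ : x ∈ Ω
  · rw [piconeTest, indicator_of_mem hxΩ, hu0 x hxΩ hx, abs_zero,
      Real.zero_rpow (zero_lt_one.trans (hp1 x hxΩ)).ne', zero_div]
  · exact indicator_of_notMem hxΩ _

variable {n N : ℕ} [TopologicalSpace M] [ChartedSpace (EuclideanSpace ℝ (Fin n)) M]
  {X : Fin N → (x : M) → TangentSpace (𝓡 n) x}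

theorem contMDiff_piconeTest [T2Space M] (hΩ : IsOpen Ω) (hp1 : ∀ x ∈ Ω, 1 < p x)
    (hpd : ContMDiffOn (𝓡 n) 𝓘(ℝ, ℝ) 1 p Ω) (hu : ContMDiffOn (𝓡 n) 𝓘(ℝ, ℝ) 1 u Ω)
    (hV : ContMDiffOn (𝓡 n) 𝓘(ℝ, ℝ) 1 V Ω) (hF : ∀ x ∈ Ω, ContDiffAt ℝ 1 F (p x, V x))
    (hF0 : ∀ x ∈ Ω, 0 < F (p x, V x)) {K : Set M} (hK : IsCompact K) (hKΩ : K ⊆ Ω)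
    (hu0 : ∀ x ∈ Ω, x ∉ K → u x = 0) :
    ContMDiff (𝓡 n) 𝓘(ℝ, ℝ) 1 (piconeTest Ω p F u V) := by
  refine contMDiff_of_eq_zero_off_closed hΩ hK.isClosed hKΩ ?_
    fun x hx => piconeTest_eq_zero hp1 hu0 hx
  intro x hx
  have h1 : ContMDiffWithinAt (𝓡 n) 𝓘(ℝ, ℝ) 1 (fun x => |u x| ^ p x) Ω x :=
    (contDiffAt_abs_rpow (z := (u x, p x)) (hp1 x hx)).contMDiffAt.comp_contMDiffWithinAt x
      ((hu x hx).prodMk_space (hpd x hx))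
  have h3 : ContMDiffAt 𝓘(ℝ, ℝ × ℝ) 𝓘(ℝ, ℝ) 1 (fun z => (F z)⁻¹) (p x, V x) :=
    ((hF x hx).inv (hF0 x hx).ne').contMDiffAt
  have h2 : ContMDiffWithinAt (𝓡 n) 𝓘(ℝ, ℝ) 1 (fun x => (F (p x, V x))⁻¹) Ω x :=
    ContMDiffAt.comp_contMDiffWithinAt (g := fun z : ℝ × ℝ => (F z)⁻¹) x h3
      ((hpd x hx).prodMk_space (hV x hx))
  refine (h1.mul h2).congr (fun y hy => ?_) ?_
  · rw [piconeTest, indicator_of_mem hy]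
    rfl
  · rw [piconeTest, indicator_of_mem hx]
    rfl

theorem horizGrad_piconeTest (hΩ : IsOpen Ω) (hp1 : ∀ x ∈ Ω, 1 < p x)
    (hpd : ContMDiffOn (𝓡 n) 𝓘(ℝ, ℝ) 1 p Ω) (hu : ContMDiffOn (𝓡 n) 𝓘(ℝ, ℝ) 1 u Ω)
    (hV : ContMDiffOn (𝓡 n) 𝓘(ℝ, ℝ) 1 V Ω) (hF : ∀ x ∈ Ω, ContDiffAt ℝ 1 F (p x, V x))
    (hF0 : ∀ x ∈ Ω, 0 < F (p x, V x)) {x : M} (hx : x ∈ Ω) :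
    ∃ γ : ℝ, horizGrad X (piconeTest Ω p F u V) x =
      ((p x * (|u x| ^ (p x - 2) * u x) / F (p x, V x)) • horizGrad X u x -
        (|u x| ^ p x * fderiv ℝ F (p x, V x) (0, 1) / F (p x, V x) ^ 2) • horizGrad X V x) +
        γ • horizGrad X p x := by
  have hnhds := hΩ.mem_nhds hx
  obtain ⟨L, hL, hL1, hL3⟩ := hasFDerivAt_abs_rpow_div (s := u x) (hp1 x hx)
    ((hF x hx).differentiableAt (by simp)).hasFDerivAt (hF0 x hx)
  refine ⟨L (0, 1, 0), ?_⟩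
  have h1 : piconeTest Ω p F u V =ᶠ[𝓝 x] fun x => |u x| ^ p x / F (p x, V x) := by
    filter_upwards [hnhds] with y hy using indicator_of_mem hy _
  rw [horizGrad_congr h1, horizGrad_comp₃ (Φ := fun z : ℝ × ℝ × ℝ => |z.1| ^ z.2.1 / F z.2) hL
    (((hu x hx).contMDiffAt hnhds).mdifferentiableAt (by simp))
    (((hpd x hx).contMDiffAt hnhds).mdifferentiableAt (by simp))
    (((hV x hx).contMDiffAt hnhds).mdifferentiableAt (by simp)), hL1, hL3, neg_smul]
  abel

end Regularity

/-- Picone's inequality at a point: the contribution of `∇(|s|^p / F)` against `|G|^{p-2} G`, where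
`F` has derivative `a` in the direction `G`, is Young's inequality
`p A^{p-1} B ≤ B^p + (p - 1) A^p` with `A = |G| |s| F^{-1/(p-1)}` and `B = |D|`. -/
theorem picone_pointwise {V : Type*} [NormedAddCommGroup V] [InnerProductSpace ℝ V] (G D : V)
    {p s F a : ℝ} (hp : 1 < p) (hF : 0 < F) (ha : (p - 1) * F ^ ((p - 2) / (p - 1)) ≤ a) :
    ‖G‖ ^ (p - 2) * inner ℝ G ((p * (|s| ^ (p - 2) * s) / F) • D - (|s| ^ p * a / F ^ 2) • G) ≤
      ‖D‖ ^ p := by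
  have hp0 : 0 < p := zero_lt_one.trans hp
  have hp1 : 0 < p - 1 := sub_pos.2 hp
  set A := ‖G‖ * |s| * F ^ (-(1 / (p - 1)))
  have hA : 0 ≤ A := by positivity
  have hAp1 : A ^ (p - 1) = ‖G‖ ^ (p - 1) * |s| ^ (p - 1) / F := by
    rw [Real.mul_rpow (by positivity) (by positivity), Real.mul_rpow (by positivity) (by positivity),
      ← Real.rpow_mul hF.le, show -(1 / (p - 1)) * (p - 1) = -1 by field_simp, Real.rpow_neg_one,
      div_eq_mul_inv]
  have hAp : A ^ p = ‖G‖ ^ p * |s| ^ p * F ^ ((p - 2) / (p - 1)) / F ^ 2 := by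
    rw [Real.mul_rpow (by positivity) (by positivity), Real.mul_rpow (by positivity) (by positivity),
      ← Real.rpow_mul hF.le, mul_div_assoc, ← Real.rpow_natCast F 2, ← Real.rpow_sub hF]
    congr 2
    push_cast
    field_simp
    ring
  have young : p * A ^ (p - 1) * ‖D‖ ≤ ‖D‖ ^ p + (p - 1) * A ^ p := by
    have h := Real.young_inequality_of_nonneg (norm_nonneg D) (Real.rpow_nonneg hA (p - 1))
      (Real.HolderConjugate.conjExponent hp)
    rw [← Real.rpow_mul hA, Real.conjExponent,
      show (p - 1) * (p / (p - 1)) = p by field_simp] at h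
    calc p * A ^ (p - 1) * ‖D‖ = p * (‖D‖ * A ^ (p - 1)) := by ring
      _ ≤ p * (‖D‖ ^ p / p + A ^ p / (p / (p - 1))) := by gcongr
      _ = ‖D‖ ^ p + (p - 1) * A ^ p := by field_simp
  have hs : |(|s| ^ (p - 2) * s)| = |s| ^ (p - 1) := by
    rcases eq_or_ne s 0 with rfl | hs
    · simp [Real.zero_rpow hp1.ne']
    · rw [abs_mul, abs_of_nonneg (by positivity : 0 ≤ |s| ^ (p - 2)),
        ← Real.rpow_add_one (abs_pos.2 hs).ne']
      ring_nf
  have hGG : ‖G‖ ^ (p - 2) * inner ℝ G G = ‖G‖ ^ p := by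
    rcases eq_or_ne G 0 with rfl | hG
    · simp [Real.zero_rpow hp0.ne']
    · rw [real_inner_self_eq_norm_sq, ← Real.rpow_natCast ‖G‖ 2,
        ← Real.rpow_add (norm_pos_iff.2 hG)]
      norm_num
  have h1 : (p * (|s| ^ (p - 2) * s) / F) * (‖G‖ ^ (p - 2) * inner ℝ G D) ≤
      p * A ^ (p - 1) * ‖D‖ := by
    refine (le_abs_self _).trans ?_
    rw [abs_mul, abs_div, abs_mul, hs, abs_of_pos hF, abs_of_pos hp0, hAp1]
    calc p * |s| ^ (p - 1) / F * |‖G‖ ^ (p - 2) * inner ℝ G D|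
        ≤ p * |s| ^ (p - 1) / F * (‖G‖ ^ (p - 1) * ‖D‖) := by
          gcongr
          exact abs_rpow_mul_inner_le _ _ _
      _ = _ := by ring
  have h2 : (p - 1) * A ^ p ≤ (|s| ^ p * a / F ^ 2) * (‖G‖ ^ (p - 2) * inner ℝ G G) := by
    rw [hGG, hAp]
    calc (p - 1) * (‖G‖ ^ p * |s| ^ p * F ^ ((p - 2) / (p - 1)) / F ^ 2)
        = |s| ^ p * ((p - 1) * F ^ ((p - 2) / (p - 1))) / F ^ 2 * ‖G‖ ^ p := by ring
      _ ≤ |s| ^ p * a / F ^ 2 * ‖G‖ ^ p := by gcongr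
  rw [inner_sub_right, inner_smul_right, inner_smul_right]
  calc _ = (p * (|s| ^ (p - 2) * s) / F) * (‖G‖ ^ (p - 2) * inner ℝ G D) -
        (|s| ^ p * a / F ^ 2) * (‖G‖ ^ (p - 2) * inner ℝ G G) := by ring
    _ ≤ ‖D‖ ^ p := by linarith

end Picone

/-! ### The weak inequality tested with `|u|^p / F(p, V)` -/

section PiconeWeak

open Filter Topology

variable {n N : ℕ} {M : Type*} [TopologicalSpace M] [ChartedSpace (EuclideanSpace ℝ (Fin n)) M]
  [IsManifold (𝓡 n) ∞ M] {X : Fin N → (x : M) → TangentSpace (𝓡 n) x}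
  [T2Space M] [SecondCountableTopology M] [MeasurableSpace M] [BorelSpace M]

/-- The weak inequality tested with `|u|^p / F(p, V)`. Orthogonality of `G` and `∇p` removes the
logarithmic terms produced by the variable exponent. -/
theorem picone_weak_ineq {vol : SmoothVolume n M}
    (hX : ∀ k, ContMDiff (𝓡 n) (𝓡 n).tangent ∞
      (fun x => (⟨x, X k x⟩ : TangentBundle (𝓡 n) M)))
    {Ω : Set M} (hΩ : IsOpen Ω) {p : M → ℝ} (hp1 : ∀ x ∈ Ω, 1 < p x)
    (hpd : ContMDiffOn (𝓡 n) 𝓘(ℝ, ℝ) 1 p Ω)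
    {G : M → EuclideanSpace ℝ (Fin N)} (hG : AEStronglyMeasurable G (vol.measure.restrict Ω))
    (hGi : Integrable (fun x => ‖G x‖ ^ (p x - 1)) (vol.measure.restrict Ω))
    (hGp : ∀ᵐ x ∂(vol.measure.restrict Ω), inner ℝ (G x) (horizGrad X p x) = 0)
    {w : M → ℝ} (hw : ∀ K ⊆ Ω, IsCompact K → IntegrableOn w K vol.measure)
    (h : ∀ φ : M → ℝ, IsTestFunction (n := n) Ω φ → (∀ x, 0 ≤ φ x) →
      ∫ x in Ω, w x * φ x ∂vol.measure ≤ pSubLaplaceForm X vol Ω p G φ)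
    {u V : M → ℝ} {F : ℝ × ℝ → ℝ} (hu : ContMDiffOn (𝓡 n) 𝓘(ℝ, ℝ) 1 u Ω)
    (hV : ContMDiffOn (𝓡 n) 𝓘(ℝ, ℝ) 1 V Ω) (hF : ∀ x ∈ Ω, ContDiffAt ℝ 1 F (p x, V x))
    (hF0 : ∀ x ∈ Ω, 0 < F (p x, V x)) {K : Set M} (hK : IsCompact K) (hKΩ : K ⊆ Ω)
    (hu0 : ∀ x ∈ Ω, x ∉ K → u x = 0) :
    Integrable (fun x => w x * (|u x| ^ p x / F (p x, V x))) (vol.measure.restrict Ω) ∧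
    ∫ x in Ω, w x * (|u x| ^ p x / F (p x, V x)) ∂vol.measure ≤
      ∫ x in Ω, ‖G x‖ ^ (p x - 2) * inner ℝ (G x)
        ((p x * (|u x| ^ (p x - 2) * u x) / F (p x, V x)) • horizGrad X u x -
        (|u x| ^ p x * fderiv ℝ F (p x, V x) (0, 1) / F (p x, V x) ^ 2) • horizGrad X V x)
        ∂vol.measure := by
  have hψ := contMDiff_piconeTest hΩ hp1 hpd hu hV hF hF0 hK hKΩ hu0
  have hψK : ∀ x ∉ K, piconeTest Ω p F u V x = 0 := fun x hx => piconeTest_eq_zero hp1 hu0 hx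
  have hψs : tsupport (piconeTest Ω p F u V) ⊆ K :=
    closure_minimal (fun x hx => by_contra fun h => hx (hψK x h)) hK.isClosed
  have key := weak_ineq_of_contMDiff_one hX hΩ
    (hpd.continuousOn.aemeasurable hΩ.measurableSet) hG hGi hw h hψ (piconeTest_nonneg hF0)
    (hK.of_isClosed_subset (isClosed_tsupport _) hψs) (hψs.trans hKΩ)
  have hint := integrable_mul_of_eq_zero_off_compact (Ω := Ω) hK (hw K hKΩ hK) hψ.continuous hψK
  have hmem : ∀ᵐ x ∂(vol.measure.restrict Ω), x ∈ Ω := ae_restrict_mem hΩ.measurableSet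
  have h1 : (fun x => w x * piconeTest Ω p F u V x) =ᵐ[vol.measure.restrict Ω]
      fun x => w x * (|u x| ^ p x / F (p x, V x)) := by
    filter_upwards [hmem] with x hx
    rw [piconeTest, indicator_of_mem hx]
  refine ⟨hint.congr h1, ?_⟩
  rw [integral_congr_ae h1] at key
  refine key.trans_eq (integral_congr_ae ?_)
  filter_upwards [hmem, hGp] with x hx hGx
  obtain ⟨γ, hγ⟩ := horizGrad_piconeTest (X := X) hΩ hp1 hpd hu hV hF hF0 hx
  rw [hγ, inner_add_right, inner_smul_right, hGx, mul_zero, add_zero]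

end PiconeWeak

/-! ### Integrals and variable exponents -/

section Integrals

open Filter Topology

theorem ofReal_integral_le_lintegral {α : Type*} [MeasurableSpace α] {μ : Measure α} {f : α → ℝ}
    (hf : Integrable f μ) : ENNReal.ofReal (∫ x, f x ∂μ) ≤ ∫⁻ x, ENNReal.ofReal (f x) ∂μ := by
  calc ENNReal.ofReal (∫ x, f x ∂μ) ≤ ENNReal.ofReal (∫ x, max (f x) 0 ∂μ) :=
        ENNReal.ofReal_le_ofReal (integral_mono hf hf.pos_part fun x => le_max_left _ _)
    _ = ∫⁻ x, ENNReal.ofReal (max (f x) 0) ∂μ :=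
        ofReal_integral_eq_lintegral_ofReal hf.pos_part
          (Eventually.of_forall fun x => le_max_right _ _)
    _ = ∫⁻ x, ENNReal.ofReal (f x) ∂μ := by simp [ENNReal.ofReal_max]

/-- Fatou's lemma for a sequence of inequalities. -/
theorem lintegral_le_of_ae_tendsto {α : Type*} [MeasurableSpace α] {μ : Measure α}
    {f : ℕ → α → ℝ≥0∞} {g : α → ℝ≥0∞} {b : ℕ → ℝ≥0∞} {B : ℝ≥0∞} (hf : ∀ k, AEMeasurable (f k) μ)
    (hfg : ∀ᵐ x ∂μ, Tendsto (fun k => f k x) atTop (𝓝 (g x)))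
    (hb : ∀ k, ∫⁻ x, f k x ∂μ ≤ b k) (hB : Tendsto b atTop (𝓝 B)) :
    ∫⁻ x, g x ∂μ ≤ B := by
  calc ∫⁻ x, g x ∂μ = ∫⁻ x, liminf (fun k => f k x) atTop ∂μ :=
        lintegral_congr_ae (hfg.mono fun x hx => hx.liminf_eq.symm)
    _ ≤ liminf (fun k => ∫⁻ x, f k x ∂μ) atTop := lintegral_liminf_le' hf
    _ ≤ liminf b atTop := liminf_le_liminf (Eventually.of_forall hb)
    _ = B := hB.liminf_eq

end Integrals

section VarLp

open Filter Topology

variable {n : ℕ} {M : Type*} [TopologicalSpace M] [ChartedSpace (EuclideanSpace ℝ (Fin n)) M]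
  [MeasurableSpace M] {V : Type*} [NormedAddCommGroup V] {vol : SmoothVolume n M} {Ω : Set M}
  {p : M → ℝ} {G : M → V}

theorem aemeasurable_norm_rpow {α : Type*} [MeasurableSpace α] {μ : Measure α} {q : α → ℝ}
    {F : α → V} (hF : AEStronglyMeasurable F μ) (hq : AEMeasurable q μ) :
    AEMeasurable (fun x => ‖F x‖ ^ q x) μ :=
  hF.norm.aemeasurable.pow hq

theorem MemVarLp.integrable_rpow (hG : MemVarLp vol Ω p G)
    (hp : AEMeasurable p (vol.measure.restrict Ω)) :
    Integrable (fun x => ‖G x‖ ^ p x) (vol.measure.restrict Ω) :=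
  (lintegral_ofReal_ne_top_iff_integrable (aemeasurable_norm_rpow hG.1 hp).aestronglyMeasurable
    (Eventually.of_forall fun _ => Real.rpow_nonneg (norm_nonneg _) _)).1 hG.2.ne

theorem rpow_sub_one_le {t q : ℝ} (ht : 0 ≤ t) (hq : 1 < q) : t ^ (q - 1) ≤ 1 + t ^ q := by
  rcases le_total t 1 with h | h
  · have := Real.rpow_le_one ht h (sub_pos.2 hq).le
    have := Real.rpow_nonneg ht q
    linarith
  · have := Real.rpow_le_rpow_of_exponent_le h (sub_le_self q zero_le_one)
    linarith

theorem MemVarLp.integrable_rpow_sub_one [IsFiniteMeasure (vol.measure.restrict Ω)]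
    (hG : MemVarLp vol Ω p G) (hp : AEMeasurable p (vol.measure.restrict Ω))
    (hp1 : ∀ᵐ x ∂(vol.measure.restrict Ω), 1 < p x) :
    Integrable (fun x => ‖G x‖ ^ (p x - 1)) (vol.measure.restrict Ω) := by
  refine ((integrable_const (1 : ℝ)).add (hG.integrable_rpow hp)).mono'
    (aemeasurable_norm_rpow hG.1 (hp.sub_const 1)).aestronglyMeasurable ?_
  filter_upwards [hp1] with x hx
  rw [Real.norm_of_nonneg (Real.rpow_nonneg (norm_nonneg _) _)]
  exact rpow_sub_one_le (norm_nonneg _) hx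

end VarLp

/-! ### The Hardy type inequality on `C¹₀(Ω)` -/

section Truncation

open Filter Topology

theorem hasDerivAt_max_zero_sq (s : ℝ) :
    HasDerivAt (fun s : ℝ => max s 0 ^ 2) (2 * max s 0) s := by
  rcases lt_trichotomy s 0 with h | rfl | h
  · rw [max_eq_right h.le, mul_zero]
    refine (hasDerivAt_const s (0 : ℝ)).congr_of_eventuallyEq ?_
    filter_upwards [gt_mem_nhds h] with t ht
    simp [max_eq_right ht.le]
  · rw [max_self, mul_zero, hasDerivAt_iff_isLittleO]
    have h1 : (fun s : ℝ => max s 0) =O[𝓝 0] fun s => s :=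
      Asymptotics.IsBigO.of_bound 1 (Eventually.of_forall fun s => by
        rw [one_mul, Real.norm_of_nonneg (le_max_right _ _)]
        exact max_le (le_abs_self s) (abs_nonneg s))
    have h2 : (fun s : ℝ => max s 0) =o[𝓝 0] fun _ => (1 : ℝ) := by
      rw [Asymptotics.isLittleO_one_iff]
      have : ContinuousAt (fun s : ℝ => max s 0) 0 := continuousAt_id.max continuousAt_const
      simpa [ContinuousAt] using this
    simpa [sq] using h1.mul_isLittleO h2
  · rw [max_eq_left h.le]
    have := (hasDerivAt_pow 2 s)
    refine HasDerivAt.congr_of_eventuallyEq (f := fun t => t ^ 2) (by simpa using this) ?_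
    filter_upwards [lt_mem_nhds h] with t ht
    simp [max_eq_left ht.le]

theorem contDiff_one_of_hasDerivAt {f f' : ℝ → ℝ} (h : ∀ s, HasDerivAt f (f' s) s)
    (hf' : Continuous f') : ContDiff ℝ 1 f := by
  rw [contDiff_one_iff_deriv]
  exact ⟨fun s => (h s).differentiableAt, by rwa [show deriv f = f' from funext fun s => (h s).deriv]⟩

/-- A `C¹` truncation of the identity of `[0, ∞)`, zero on `(-∞, ε]` with slope in `[0, 1)`. -/
noncomputable def softTrunc (ε s : ℝ) : ℝ := √(max (s - ε) 0 ^ 2 + ε ^ 2) - ε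

variable {ε : ℝ}

theorem hasDerivAt_softTrunc (hε : 0 < ε) (s : ℝ) :
    HasDerivAt (softTrunc ε) (max (s - ε) 0 / √(max (s - ε) 0 ^ 2 + ε ^ 2)) s := by
  have h1 : HasDerivAt (fun s => max (s - ε) 0 ^ 2 + ε ^ 2) (2 * max (s - ε) 0) s := by
    have := (hasDerivAt_max_zero_sq (s - ε)).comp s ((hasDerivAt_id s).sub_const ε)
    simpa using this.add_const (ε ^ 2)
  have h2 := (h1.sqrt (by positivity)).sub_const ε
  refine h2.congr_deriv ?_
  rw [mul_div_mul_left _ _ two_ne_zero]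

theorem contDiff_softTrunc (hε : 0 < ε) : ContDiff ℝ 1 (softTrunc ε) := by
  refine contDiff_one_of_hasDerivAt (hasDerivAt_softTrunc hε) ?_
  refine Continuous.div (by fun_prop) (by fun_prop) fun s => ?_
  positivity

theorem softTrunc_eq_zero (hε : 0 < ε) {s : ℝ} (hs : s ≤ ε) : softTrunc ε s = 0 := by
  rw [softTrunc, max_eq_right (by linarith)]
  simp [Real.sqrt_sq hε.le]

theorem abs_deriv_softTrunc_le (hε : 0 < ε) (s : ℝ) :
    |max (s - ε) 0 / √(max (s - ε) 0 ^ 2 + ε ^ 2)| ≤ 1 := by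
  rw [abs_of_nonneg (by positivity), div_le_one (by positivity)]
  exact Real.le_sqrt_of_sq_le (by nlinarith)

theorem tendsto_softTrunc {s : ℝ} (hs : 0 ≤ s) :
    Tendsto (fun ε => softTrunc ε s) (𝓝 0) (𝓝 s) := by
  have : Continuous fun ε => softTrunc ε s := by
    unfold softTrunc
    fun_prop
  have h := this.tendsto 0
  simpa [softTrunc, max_eq_left hs, Real.sqrt_sq hs] using h

end Truncation

section Hardy

open Filter Topology

variable {n N : ℕ} {M : Type*} [TopologicalSpace M] [ChartedSpace (EuclideanSpace ℝ (Fin n)) M]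
  [IsManifold (𝓡 n) ∞ M] {X : Fin N → (x : M) → TangentSpace (𝓡 n) x}
  [T2Space M] [SecondCountableTopology M] [MeasurableSpace M] [BorelSpace M]

/-- The Hardy inequality for `C¹` functions on `Ω` vanishing off a compact subset of `Ω`. -/
theorem hardy_of_compact_support {vol : SmoothVolume n M}
    (hX : ∀ k, ContMDiff (𝓡 n) (𝓡 n).tangent ∞
      (fun x => (⟨x, X k x⟩ : TangentBundle (𝓡 n) M)))
    {Ω : Set M} (hΩ : IsOpen Ω) (hΩb : IsCompact (closure Ω)) {p : M → ℝ}
    (hp1 : ∀ x ∈ Ω, 1 < p x) (hpd : ContMDiffOn (𝓡 n) 𝓘(ℝ, ℝ) 1 p Ω)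
    {c : ℝ} {a : M → ℝ} {f : ℝ → ℝ} {v : M → ℝ} (hc : 0 < c) (ha : ContinuousOn a Ω)
    (ha0 : ∀ x ∈ Ω, 0 < a x) (hf : PiconeGrowth Ω p f) (hv : IsPositiveSolution X vol Ω p c a f v)
    (hvp : ∀ x ∈ Ω, inner ℝ (horizGrad X v x) (horizGrad X p x) = 0)
    {u : M → ℝ} (hu : ContMDiffOn (𝓡 n) 𝓘(ℝ, ℝ) 1 u Ω) {K : Set M} (hK : IsCompact K)
    (hKΩ : K ⊆ Ω) (hu0 : ∀ x ∈ Ω, x ∉ K → u x = 0) :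
    ENNReal.ofReal c * ∫⁻ x in Ω, ENNReal.ofReal (a x * |u x| ^ p x) ∂vol.measure ≤
      ∫⁻ x in Ω, ENNReal.ofReal (‖horizGrad X u x‖ ^ p x) ∂vol.measure := by
  have := vol.isLocallyFiniteMeasure
  have hfin : IsFiniteMeasure (vol.measure.restrict Ω) :=
    isFiniteMeasure_restrict.2 (measure_lt_top_mono subset_closure hΩb.measure_lt_top).ne
  have hmem : ∀ᵐ x ∂(vol.measure.restrict Ω), x ∈ Ω := ae_restrict_mem hΩ.measurableSet
  have hpm : AEMeasurable p (vol.measure.restrict Ω) :=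
    hpd.continuousOn.aemeasurable hΩ.measurableSet
  have hv1 : ContMDiffOn (𝓡 n) 𝓘(ℝ, ℝ) 1 v Ω := hv.smooth.of_le (by simp)
  have hG := hv.memW10.1.2.1
  have hGi := hG.integrable_rpow_sub_one hpm (hmem.mono hp1)
  have hfv : ContinuousOn (fun x => c * (a x * f (v x))) Ω :=
    continuousOn_const.mul (ha.mul (hf.contDiffOn.continuousOn.comp hv1.continuousOn hv.pos))
  have hfC : ∀ y > 0, ContDiffAt ℝ 1 f y := fun y hy => hf.contDiffOn.contDiffAt (Ioi_mem_nhds hy)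
  have hF : ∀ x ∈ Ω, ContDiffAt ℝ 1 (fun z : ℝ × ℝ => f z.2) (p x, v x) := fun x hx =>
    (hfC _ (hv.pos x hx)).comp (p x, v x) contDiffAt_snd
  have hF' : ∀ x ∈ Ω, fderiv ℝ (fun z : ℝ × ℝ => f z.2) (p x, v x) (0, 1) = deriv f (v x) := by
    intro x hx
    have h1 : HasFDerivAt (fun z : ℝ × ℝ => f z.2) (deriv f (v x) • ContinuousLinearMap.snd ℝ ℝ ℝ)
        (p x, v x) := HasDerivAt.comp_hasFDerivAt (h₂ := f) (f := Prod.snd) (p x, v x)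
          ((hfC _ (hv.pos x hx)).differentiableAt (by simp)).hasDerivAt hasFDerivAt_snd
    simp [h1.fderiv]
  obtain ⟨hi, hle⟩ := picone_weak_ineq hX hΩ hp1 hpd hG.1 hGi
    (hmem.mono hvp) (w := fun x => c * (a x * f (v x)))
    (fun K hK hKc => (hfv.mono hK).integrableOn_compact hKc)
    (fun φ hφ _ => by
      rw [hv.weak_eq φ hφ, ← integral_const_mul]
      exact (integral_congr_ae (Eventually.of_forall fun x => by ring)).le)
    hu hv1 hF (fun x hx => hf.pos _ (hv.pos x hx)) hK hKΩ hu0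
  have hrw : ∀ x ∈ Ω, c * (a x * f (v x)) * (|u x| ^ p x / f (v x)) = c * (a x * |u x| ^ p x) := by
    intro x hx
    have := hf.pos _ (hv.pos x hx)
    field_simp
  rw [← lintegral_const_mul' _ _ ENNReal.ofReal_ne_top]
  calc ∫⁻ x in Ω, ENNReal.ofReal c * ENNReal.ofReal (a x * |u x| ^ p x) ∂vol.measure
      = ∫⁻ x in Ω, ENNReal.ofReal (c * (a x * f (v x)) * (|u x| ^ p x / f (v x))) ∂vol.measure := by
        refine lintegral_congr_ae (hmem.mono fun x hx => ?_)
        simp only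
        rw [hrw x hx, ENNReal.ofReal_mul hc.le]
    _ = ENNReal.ofReal (∫ x in Ω, c * (a x * f (v x)) * (|u x| ^ p x / f (v x)) ∂vol.measure) := by
        refine (ofReal_integral_eq_lintegral_ofReal hi (hmem.mono fun x hx => ?_)).symm
        have := ha0 x hx
        simp only [Pi.zero_apply]
        rw [hrw x hx]
        positivity
    _ ≤ _ := ENNReal.ofReal_le_ofReal hle
    _ ≤ ∫⁻ x in Ω, ENNReal.ofReal (‖horizGrad X v x‖ ^ (p x - 2) * inner ℝ (horizGrad X v x)
        ((p x * (|u x| ^ (p x - 2) * u x) / f (v x)) • horizGrad X u x -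
        (|u x| ^ p x * fderiv ℝ (fun z : ℝ × ℝ => f z.2) (p x, v x) (0, 1) / f (v x) ^ 2) •
          horizGrad X v x)) ∂vol.measure := by
        by_cases hint : Integrable (fun x => ‖horizGrad X v x‖ ^ (p x - 2) *
          inner ℝ (horizGrad X v x)
          ((p x * (|u x| ^ (p x - 2) * u x) / f (v x)) • horizGrad X u x -
          (|u x| ^ p x * fderiv ℝ (fun z : ℝ × ℝ => f z.2) (p x, v x) (0, 1) / f (v x) ^ 2) •
            horizGrad X v x)) (vol.measure.restrict Ω)
        · exact ofReal_integral_le_lintegral hint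
        · rw [integral_undef hint]
          simp
    _ ≤ _ := by
        refine lintegral_mono_ae (hmem.mono fun x hx => ENNReal.ofReal_le_ofReal ?_)
        rw [hF' x hx]
        exact picone_pointwise _ _ (hp1 x hx) (hf.pos _ (hv.pos x hx))
          (hf.deriv_ge x hx _ (hv.pos x hx))

/-- The Hardy inequality on `C¹₀(Ω)`: `softTrunc ε ∘ u` vanishes off the compact set `{u ≥ ε}`, and its
gradient is dominated by that of `u`. -/
theorem hardy_of_isC1Zero {vol : SmoothVolume n M}
    (hX : ∀ k, ContMDiff (𝓡 n) (𝓡 n).tangent ∞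
      (fun x => (⟨x, X k x⟩ : TangentBundle (𝓡 n) M)))
    {Ω : Set M} (hΩ : IsOpen Ω) (hΩb : IsCompact (closure Ω)) {p : M → ℝ}
    (hp1 : ∀ x ∈ Ω, 1 < p x) (hpd : ContMDiffOn (𝓡 n) 𝓘(ℝ, ℝ) 1 p Ω)
    {c : ℝ} {a : M → ℝ} {f : ℝ → ℝ} {v : M → ℝ} (hc : 0 < c) (ha : ContinuousOn a Ω)
    (ha0 : ∀ x ∈ Ω, 0 < a x) (hf : PiconeGrowth Ω p f) (hv : IsPositiveSolution X vol Ω p c a f v)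
    (hvp : ∀ x ∈ Ω, inner ℝ (horizGrad X v x) (horizGrad X p x) = 0)
    {u : M → ℝ} (hu : IsC1Zero (n := n) Ω u) (hu0 : ∀ x ∈ Ω, 0 ≤ u x) :
    ENNReal.ofReal c * ∫⁻ x in Ω, ENNReal.ofReal (a x * |u x| ^ p x) ∂vol.measure ≤
      ∫⁻ x in Ω, ENNReal.ofReal (‖horizGrad X u x‖ ^ p x) ∂vol.measure := by
  obtain ⟨hu1, huc, hub⟩ := hu
  have hmem : ∀ᵐ x ∂(vol.measure.restrict Ω), x ∈ Ω := ae_restrict_mem hΩ.measurableSet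
  have htrunc : ∀ ε > 0, ∫⁻ x in Ω, ENNReal.ofReal c *
      ENNReal.ofReal (a x * |softTrunc ε (u x)| ^ p x) ∂vol.measure ≤
      ∫⁻ x in Ω, ENNReal.ofReal (‖horizGrad X u x‖ ^ p x) ∂vol.measure := by
    intro ε hε
    have hK : IsCompact (closure Ω ∩ u ⁻¹' Ici ε) := hΩb.of_isClosed_subset
      (huc.preimage_isClosed_of_isClosed isClosed_closure isClosed_Ici) inter_subset_left
    have hKΩ : closure Ω ∩ u ⁻¹' Ici ε ⊆ Ω := by
      rintro x ⟨hx, hxu⟩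
      by_contra hxΩ
      have := hub x (by rw [hΩ.frontier_eq]; exact ⟨hx, hxΩ⟩)
      rw [mem_preimage, this, mem_Ici] at hxu
      linarith
    rw [lintegral_const_mul' _ _ ENNReal.ofReal_ne_top]
    refine (hardy_of_compact_support hX hΩ hΩb hp1 hpd hc ha ha0 hf hv hvp
      (u := fun x => softTrunc ε (u x)) ((contDiff_softTrunc hε).contMDiff.comp_contMDiffOn hu1)
      hK hKΩ fun x hx hxK => ?_).trans (lintegral_mono_ae (hmem.mono fun x hx => ?_))
    · refine softTrunc_eq_zero hε (not_lt.1 fun h => hxK ⟨subset_closure hx, h.le⟩)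
    · refine ENNReal.ofReal_le_ofReal (Real.rpow_le_rpow (norm_nonneg _) ?_
        (zero_lt_one.trans (hp1 x hx)).le)
      have hud := ((hu1 x hx).contMDiffAt (hΩ.mem_nhds hx)).mdifferentiableAt one_ne_zero
      have hd : HasFDerivAt (fun z : ℝ × ℝ × ℝ => softTrunc ε z.1)
          ((max (u x - ε) 0 / √(max (u x - ε) 0 ^ 2 + ε ^ 2)) •
            ContinuousLinearMap.fst ℝ ℝ (ℝ × ℝ)) (u x, u x, u x) :=
        HasDerivAt.comp_hasFDerivAt (h₂ := softTrunc ε) (f := Prod.fst) (u x, u x, u x)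
          (hasDerivAt_softTrunc hε _) hasFDerivAt_fst
      rw [horizGrad_comp₃ hd hud hud hud]
      have := abs_deriv_softTrunc_le hε (u x)
      simp only [smul_apply, ContinuousLinearMap.coe_fst', smul_eq_mul, mul_one,
        mul_zero, zero_smul, add_zero, norm_smul, Real.norm_eq_abs]
      exact mul_le_of_le_one_left (norm_nonneg _) this
  rw [← lintegral_const_mul' _ _ ENNReal.ofReal_ne_top]
  refine lintegral_le_of_ae_tendsto (f := fun k x => ENNReal.ofReal c *
    ENNReal.ofReal (a x * |softTrunc (1 / ((k : ℝ) + 1)) (u x)| ^ p x)) (fun k => ?_)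
    (hmem.mono fun x hx => ?_)
    (fun k => htrunc _ Nat.one_div_pos_of_nat) tendsto_const_nhds
  · have h1 : ContinuousOn (fun x => a x * |softTrunc (1 / ((k : ℝ) + 1)) (u x)| ^ p x) Ω :=
      ha.mul (((contDiff_softTrunc Nat.one_div_pos_of_nat).continuous.comp_continuousOn
        hu1.continuousOn).abs.rpow hpd.continuousOn fun x hx =>
          Or.inr (zero_lt_one.trans (hp1 x hx)))
    exact ((h1.aemeasurable hΩ.measurableSet).ennreal_ofReal).const_mul _
  · refine ENNReal.Tendsto.const_mul (ENNReal.tendsto_ofReal ?_) (Or.inr ENNReal.ofReal_ne_top)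
    refine Tendsto.const_mul _ (Tendsto.rpow ?_ tendsto_const_nhds
      (Or.inr (zero_lt_one.trans (hp1 x hx))))
    exact ((tendsto_softTrunc (hu0 x hx)).comp tendsto_one_div_add_atTop_nhds_zero_nat).abs

end Hardy

/-! ### Approximation in the Luxemburg norm -/

section Luxemburg

open Filter Topology

variable {n : ℕ} {M : Type*} [TopologicalSpace M] [ChartedSpace (EuclideanSpace ℝ (Fin n)) M]
  [MeasurableSpace M] {V : Type*} [NormedAddCommGroup V]
  {vol : SmoothVolume n M} {Ω : Set M} {p : M → ℝ}

theorem modular_lt_top_of_bounded [IsFiniteMeasure (vol.measure.restrict Ω)]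
    (hp1 : ∀ᵐ x ∂(vol.measure.restrict Ω), 1 < p x) {P : ℝ}
    (hP : ∀ᵐ x ∂(vol.measure.restrict Ω), p x ≤ P) {F : M → V} {C : ℝ} (hC : ∀ x, ‖F x‖ ≤ C) :
    modular vol Ω p F < ⊤ := by
  refine lt_of_le_of_lt (lintegral_mono_ae (g := fun _ => ENNReal.ofReal ((1 + |C|) ^ P)) ?_) ?_
  · filter_upwards [hp1, hP] with x hx hxP
    refine ENNReal.ofReal_le_ofReal ?_
    calc ‖F x‖ ^ p x ≤ (1 + |C|) ^ p x := by
          have := (hC x).trans (le_abs_self C)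
          exact Real.rpow_le_rpow (norm_nonneg _) (by linarith) (zero_lt_one.trans hx).le
      _ ≤ (1 + |C|) ^ P :=
          Real.rpow_le_rpow_of_exponent_le (by linarith [abs_nonneg C]) hxP
  · rw [lintegral_const]
    exact ENNReal.mul_lt_top ENNReal.ofReal_lt_top (measure_lt_top _ _)

variable [NormedSpace ℝ V]

/-- For exponents at least one, a factor `r ≤ 1` scales the modular by at most `r`. -/
theorem modular_smul_le (hp1 : ∀ᵐ x ∂(vol.measure.restrict Ω), 1 < p x) {F : M → V} {r : ℝ}
    (hr0 : 0 ≤ r) (hr : r ≤ 1) :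
    modular vol Ω p (fun x => r • F x) ≤ ENNReal.ofReal r * modular vol Ω p F := by
  rw [modular, modular, ← lintegral_const_mul' _ _ ENNReal.ofReal_ne_top]
  refine lintegral_mono_ae (hp1.mono fun x hx => ?_)
  rw [← ENNReal.ofReal_mul hr0, norm_smul, Real.norm_of_nonneg hr0,
    Real.mul_rpow hr0 (norm_nonneg _)]
  refine ENNReal.ofReal_le_ofReal (mul_le_mul_of_nonneg_right ?_ (by positivity))
  rcases hr0.eq_or_lt with rfl | h
  · rw [Real.zero_rpow (zero_lt_one.trans hx).ne']
  · simpa using Real.rpow_le_rpow_of_exponent_ge h hr hx.le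

/-- If `F` is a multiple of a function of finite modular, the infimum in the Luxemburg norm is over
a nonempty set, so that the norm controls the modular. -/
theorem modular_inv_smul_le_one (hp1 : ∀ᵐ x ∂(vol.measure.restrict Ω), 1 < p x) {F : M → V}
    (hF : modular vol Ω p (fun x => (2 : ℝ)⁻¹ • F x) < ⊤) {ε : ℝ}
    (h : luxNorm vol Ω p F < ε) : modular vol Ω p (fun x => ε⁻¹ • F x) ≤ 1 := by
  have hne : {t : ℝ | 0 < t ∧ modular vol Ω p (fun x => t⁻¹ • F x) ≤ 1}.Nonempty := by
    set m := (modular vol Ω p (fun x => (2 : ℝ)⁻¹ • F x)).toReal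
    have hm : 0 ≤ m := ENNReal.toReal_nonneg
    refine ⟨(m + 1) * 2, by positivity, ?_⟩
    have h1 : (fun x => ((m + 1) * 2)⁻¹ • F x) = fun x => (m + 1)⁻¹ • ((2 : ℝ)⁻¹ • F x) := by
      ext x
      rw [smul_smul, mul_inv]
    rw [h1]
    refine (modular_smul_le hp1 (by positivity) (inv_le_one_of_one_le₀ (by linarith))).trans ?_
    rw [← ENNReal.ofReal_toReal hF.ne, ← ENNReal.ofReal_mul (by positivity), ← ENNReal.ofReal_one]
    refine ENNReal.ofReal_le_ofReal ?_
    rw [inv_mul_le_iff₀ (by positivity), mul_one]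
    exact (lt_add_one m).le
  obtain ⟨t, ⟨ht0, ht⟩, htε⟩ := exists_lt_of_csInf_lt hne h
  refine (lintegral_mono_ae (hp1.mono fun x hx => ENNReal.ofReal_le_ofReal ?_)).trans ht
  refine Real.rpow_le_rpow (norm_nonneg _) ?_ (zero_lt_one.trans hx).le
  rw [norm_smul, norm_smul, Real.norm_of_nonneg (inv_nonneg.2 ht0.le),
    Real.norm_of_nonneg (inv_nonneg.2 (ht0.trans htε).le)]
  gcongr

theorem modular_half_sub_lt_top (hp1 : ∀ᵐ x ∂(vol.measure.restrict Ω), 1 < p x) {F H : M → V}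
    (hpm : AEMeasurable p (vol.measure.restrict Ω)) (hF : MemVarLp vol Ω p F)
    (hH : modular vol Ω p H < ⊤) :
    modular vol Ω p (fun x => (2 : ℝ)⁻¹ • (F x - H x)) < ⊤ := by
  refine lt_of_le_of_lt (b := modular vol Ω p F + modular vol Ω p H) ?_
    (ENNReal.add_lt_top.2 ⟨hF.2, hH⟩)
  rw [modular, modular, modular, ← lintegral_add_left'
    (aemeasurable_norm_rpow hF.1 hpm).ennreal_ofReal]
  refine lintegral_mono_ae (hp1.mono fun x hx => ?_)
  rw [← ENNReal.ofReal_add (by positivity) (by positivity)]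
  refine ENNReal.ofReal_le_ofReal ?_
  have h1 : ‖(2 : ℝ)⁻¹ • (F x - H x)‖ ≤ max ‖F x‖ ‖H x‖ := by
    rw [norm_smul, Real.norm_of_nonneg (by norm_num)]
    have := norm_sub_le (F x) (H x)
    have := le_max_left ‖F x‖ ‖H x‖
    have := le_max_right ‖F x‖ ‖H x‖
    linarith
  refine (Real.rpow_le_rpow (norm_nonneg _) h1 (zero_lt_one.trans hx).le).trans ?_
  have hF0 : 0 ≤ ‖F x‖ ^ p x := by positivity
  have hH0 : 0 ≤ ‖H x‖ ^ p x := by positivity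
  rcases max_choice ‖F x‖ ‖H x‖ with h | h <;> rw [h] <;> linarith

/-- Fast convergence of modulars implies convergence almost everywhere. -/
theorem ae_tendsto_of_modular_le_one (hp1 : ∀ᵐ x ∂(vol.measure.restrict Ω), 1 < p x)
    (hpm : AEMeasurable p (vol.measure.restrict Ω)) {F : M → V} {H : ℕ → M → V}
    (hF : AEStronglyMeasurable F (vol.measure.restrict Ω))
    (hH : ∀ k, AEStronglyMeasurable (H k) (vol.measure.restrict Ω))
    (h : ∀ k, modular vol Ω p (fun x => ((1 / 2 : ℝ) ^ k)⁻¹ • (F x - H k x)) ≤ 1) :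
    ∀ᵐ x ∂(vol.measure.restrict Ω), Tendsto (fun k => H k x) atTop (𝓝 (F x)) := by
  set f : ℕ → M → ℝ≥0∞ := fun k x => ENNReal.ofReal (‖F x - H k x‖ ^ p x)
  have hle : ∀ k, ∫⁻ x in Ω, f k x ∂vol.measure ≤ ENNReal.ofReal ((1 / 2 : ℝ) ^ k) := by
    intro k
    have hk : (0 : ℝ) < (1 / 2) ^ k := by positivity
    have h1 := modular_smul_le hp1 (F := fun x => ((1 / 2 : ℝ) ^ k)⁻¹ • (F x - H k x)) hk.le
      (pow_le_one₀ (by norm_num) (by norm_num))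
    simp only [smul_smul, mul_inv_cancel₀ hk.ne', one_smul] at h1
    exact h1.trans (by simpa using mul_le_mul_right (h k) (ENNReal.ofReal ((1 / 2 : ℝ) ^ k)))
  have hfm : ∀ k, AEMeasurable (f k) (vol.measure.restrict Ω) := fun k =>
    (aemeasurable_norm_rpow (hF.sub (hH k)) hpm).ennreal_ofReal
  have hsum : ∫⁻ x in Ω, ∑' k, f k x ∂vol.measure ≠ ⊤ := by
    rw [lintegral_tsum hfm]
    refine ne_top_of_le_ne_top ?_ (ENNReal.tsum_le_tsum hle)
    rw [← ENNReal.ofReal_tsum_of_nonneg (fun k => by positivity) summable_geometric_two]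
    exact ENNReal.ofReal_ne_top
  filter_upwards [ae_lt_top' (AEMeasurable.tsum hfm) hsum, hp1] with x hx hxp
  have h1 := ENNReal.tendsto_atTop_zero_of_tsum_ne_top hx.ne
  have h2 : Tendsto (fun k => ‖F x - H k x‖ ^ p x) atTop (𝓝 0) := by
    have := (ENNReal.tendsto_toReal ENNReal.zero_ne_top).comp h1
    refine this.congr fun k => ?_
    exact ENNReal.toReal_ofReal (by positivity)
  have hp0 : 0 < p x := zero_lt_one.trans hxp
  have h3 : Tendsto (fun k => ‖F x - H k x‖) atTop (𝓝 0) := by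
    have := h2.rpow_const (p := (p x)⁻¹) (Or.inr (by positivity))
    rw [Real.zero_rpow (inv_pos.2 hp0).ne'] at this
    refine this.congr fun k => ?_
    rw [← Real.rpow_mul (norm_nonneg _), mul_inv_cancel₀ hp0.ne', Real.rpow_one]
  rw [tendsto_iff_norm_sub_tendsto_zero]
  exact h3.congr fun k => norm_sub_rev _ _

/-- By convexity of `t ↦ t ^ p`, a perturbation of small Luxemburg norm increases the modular only
slightly, uniformly for exponents bounded by `P`. -/
theorem modular_le_of_modular_sub_le_one (hp1 : ∀ᵐ x ∂(vol.measure.restrict Ω), 1 < p x) {P : ℝ}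
    (hP : ∀ᵐ x ∂(vol.measure.restrict Ω), p x ≤ P)
    (hpm : AEMeasurable p (vol.measure.restrict Ω)) {F H : M → V}
    (hF : AEStronglyMeasurable F (vol.measure.restrict Ω)) {ε : ℝ} (hε : 0 < ε) (hε1 : ε < 1)
    (h : modular vol Ω p (fun x => ε⁻¹ • (F x - H x)) ≤ 1) :
    modular vol Ω p H ≤ ENNReal.ofReal ((1 - ε) ^ (1 - P)) * modular vol Ω p F +
      ENNReal.ofReal ε := by
  have hε' : 0 < 1 - ε := sub_pos.2 hε1
  calc modular vol Ω p H ≤ ∫⁻ x in Ω, (ENNReal.ofReal ((1 - ε) ^ (1 - P)) *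
        ENNReal.ofReal (‖F x‖ ^ p x) +
        ENNReal.ofReal ε * ENNReal.ofReal (‖ε⁻¹ • (F x - H x)‖ ^ p x)) ∂vol.measure := by
        refine lintegral_mono_ae ?_
        filter_upwards [hp1, hP] with x hx hxP
        rw [← ENNReal.ofReal_mul (by positivity), ← ENNReal.ofReal_mul (by positivity),
          ← ENNReal.ofReal_add (by positivity) (by positivity)]
        refine ENNReal.ofReal_le_ofReal ?_
        have h1 : ‖H x‖ ≤ (1 - ε) * ((1 - ε)⁻¹ * ‖F x‖) + ε * ‖ε⁻¹ • (F x - H x)‖ := by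
          rw [norm_smul, Real.norm_of_nonneg (inv_nonneg.2 hε.le), mul_inv_cancel_left₀ hε'.ne',
            mul_inv_cancel_left₀ hε.ne']
          calc ‖H x‖ = ‖F x - (F x - H x)‖ := by simp
            _ ≤ _ := norm_sub_le _ _
        refine (Real.rpow_le_rpow (norm_nonneg _) h1 (zero_lt_one.trans hx).le).trans ?_
        refine ((convexOn_rpow hx.le).2 (mem_Ici.2 (by positivity)) (mem_Ici.2 (by positivity))
          hε'.le hε.le (by ring)).trans ?_
        simp only [smul_eq_mul]
        refine add_le_add ?_ le_rfl
        rw [Real.mul_rpow (by positivity) (by positivity), ← mul_assoc]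
        refine mul_le_mul_of_nonneg_right ?_ (by positivity)
        calc (1 - ε) * (1 - ε)⁻¹ ^ p x = (1 - ε) ^ (1 - p x) := by
              rw [Real.inv_rpow hε'.le, Real.rpow_sub hε', Real.rpow_one, div_eq_mul_inv]
          _ ≤ (1 - ε) ^ (1 - P) :=
              Real.rpow_le_rpow_of_exponent_ge hε' (by linarith) (by linarith)
    _ = ENNReal.ofReal ((1 - ε) ^ (1 - P)) * modular vol Ω p F +
        ENNReal.ofReal ε * modular vol Ω p (fun x => ε⁻¹ • (F x - H x)) := by
        rw [lintegral_add_left' ((aemeasurable_norm_rpow hF hpm).ennreal_ofReal.const_mul _),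
          lintegral_const_mul' _ _ ENNReal.ofReal_ne_top,
          lintegral_const_mul' _ _ ENNReal.ofReal_ne_top]
        rfl
    _ ≤ _ := by
        refine add_le_add le_rfl ?_
        simpa using mul_le_mul_right h (ENNReal.ofReal ε)

end Luxemburg

section Density

open Filter Topology

variable {n N : ℕ} {M : Type*} [TopologicalSpace M] [ChartedSpace (EuclideanSpace ℝ (Fin n)) M]
  [IsManifold (𝓡 n) ∞ M] {X : Fin N → (x : M) → TangentSpace (𝓡 n) x}
  [MeasurableSpace M]

/-- Elements of `W₀^{1,p(·)}(Ω)` are limits of test functions in the modular sense. -/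
theorem MemW10.exists_test_modular {vol : SmoothVolume n M}
    (hX : ∀ k, ContMDiff (𝓡 n) (𝓡 n).tangent ∞
      (fun x => (⟨x, X k x⟩ : TangentBundle (𝓡 n) M)))
    {Ω : Set M} [IsFiniteMeasure (vol.measure.restrict Ω)] {p : M → ℝ}
    (hpm : AEMeasurable p (vol.measure.restrict Ω))
    (hp1 : ∀ᵐ x ∂(vol.measure.restrict Ω), 1 < p x) {P : ℝ}
    (hP : ∀ᵐ x ∂(vol.measure.restrict Ω), p x ≤ P) {u : M → ℝ} {U : M → EuclideanSpace ℝ (Fin N)}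
    (hu : MemW10 X vol Ω p u U) {ε : ℝ} (hε : 0 < ε) :
    ∃ φ : M → ℝ, IsTestFunction (n := n) Ω φ ∧
      modular vol Ω p (fun x => ε⁻¹ • (u x - φ x)) ≤ 1 ∧
      modular vol Ω p (fun x => ε⁻¹ • (U x - horizGrad X φ x)) ≤ 1 := by
  obtain ⟨φ, hφ, hlt⟩ := hu.2 ε hε
  have h0 : 0 ≤ luxNorm vol Ω p (fun x => u x - φ x) := Real.sInf_nonneg fun t ht => ht.1.le
  have h0' : 0 ≤ luxNorm vol Ω p (fun x => U x - horizGrad X φ x) :=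
    Real.sInf_nonneg fun t ht => ht.1.le
  have hφ1 : ContMDiff (𝓡 n) 𝓘(ℝ, ℝ) 1 φ := hφ.1.of_le (by simp)
  obtain ⟨C, hC⟩ := exists_bound_of_continuous_of_eq_zero hφ.2.1.isCompact
    hφ.1.continuous.continuousOn fun x hx => image_eq_zero_of_notMem_tsupport hx
  obtain ⟨C', hC'⟩ := exists_bound_horizGrad hX hφ1 hφ.2.1
  exact ⟨φ, hφ, modular_inv_smul_le_one hp1 (modular_half_sub_lt_top hp1 hpm hu.1.1
      (modular_lt_top_of_bounded hp1 hP hC)) (by linarith),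
    modular_inv_smul_le_one hp1 (modular_half_sub_lt_top hp1 hpm hu.1.2.1
      (modular_lt_top_of_bounded hp1 hP hC')) (by linarith)⟩

end Density

/-! ### The Hardy type inequality on `W₀^{1,p(·)}(Ω)` -/

section Shift

/-- A positive `C¹` function on the line equal to `s + ε` for `s ≥ 0`. Being bounded below by `3ε/4`, it
can be composed with approximations of a positive function that change sign, while Picone's
inequality needs the slope one only on the values of the positive limit. -/
noncomputable def softShift (ε s : ℝ) : ℝ := s + ε + max (-s) 0 ^ 2 / ε

/-- The derivative of `softShift ε`. -/
noncomputable def softShiftDeriv (ε s : ℝ) : ℝ := 1 - 2 * max (-s) 0 / ε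

variable {ε : ℝ}

theorem hasDerivAt_softShift (ε s : ℝ) : HasDerivAt (softShift ε) (softShiftDeriv ε s) s := by
  have h1 : HasDerivAt (fun s : ℝ => max (-s) 0 ^ 2) (2 * max (-s) 0 * -1) s :=
    (hasDerivAt_max_zero_sq (-s)).comp s (hasDerivAt_neg s)
  refine (((hasDerivAt_id s).add_const ε).add (h1.div_const ε)).congr_deriv ?_
  rw [softShiftDeriv]
  ring

theorem continuous_softShiftDeriv (ε : ℝ) : Continuous (softShiftDeriv ε) := by
  unfold softShiftDeriv
  fun_prop

theorem contDiff_softShift (ε : ℝ) : ContDiff ℝ 1 (softShift ε) :=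
  contDiff_one_of_hasDerivAt (hasDerivAt_softShift ε) (continuous_softShiftDeriv ε)

theorem softShift_lower (hε : 0 < ε) (s : ℝ) : 3 / 4 * ε ≤ softShift ε s := by
  have h := le_max_left (-s) 0
  have h1 : 0 ≤ (max (-s) 0 - ε / 2) ^ 2 / ε := by positivity
  have h2 : (max (-s) 0 - ε / 2) ^ 2 / ε = max (-s) 0 ^ 2 / ε - max (-s) 0 + ε / 4 := by
    field_simp
    ring
  rw [softShift]
  linarith

theorem softShift_pos (hε : 0 < ε) (s : ℝ) : 0 < softShift ε s :=
  (by positivity : (0 : ℝ) < 3 / 4 * ε).trans_le (softShift_lower hε s)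

theorem abs_softShiftDeriv_le (hε : 0 < ε) (s : ℝ) :
    |softShiftDeriv ε s| ≤ 2 / ε * softShift ε s := by
  have h := le_max_left (-s) 0
  have h0 := le_max_right (-s) 0
  set t := max (-s) 0
  have h3 : ε - t + t ^ 2 / ε ≤ softShift ε s := by
    rw [softShift]
    linarith
  have h4 : 2 / ε * (ε - t + t ^ 2 / ε) ≤ 2 / ε * softShift ε s := by gcongr
  refine le_trans ?_ h4
  have h5 : 2 / ε * (ε - t + t ^ 2 / ε) = 2 - 2 * (t / ε) + 2 * (t / ε) ^ 2 := by
    field_simp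
  rw [h5, softShiftDeriv, show 2 * max (-s) 0 / ε = 2 * (t / ε) by simp only [t]; ring,
    abs_le]
  constructor <;> nlinarith [sq_nonneg (t / ε - 1), sq_nonneg (t / ε)]

theorem softShift_of_nonneg {s : ℝ} (hs : 0 ≤ s) : softShift ε s = s + ε := by
  simp [softShift, hs]

theorem softShiftDeriv_of_nonneg {s : ℝ} (hs : 0 ≤ s) : softShiftDeriv ε s = 1 := by
  simp [softShiftDeriv, hs]

theorem contDiffAt_softShift_rpow (hε : 0 < ε) (z : ℝ × ℝ) :
    ContDiffAt ℝ 1 (fun z : ℝ × ℝ => softShift ε z.2 ^ (z.1 - 1)) z :=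
  ((contDiff_softShift ε).contDiffAt.comp z contDiffAt_snd).rpow
    (contDiffAt_fst.sub contDiffAt_const) (softShift_pos hε _).ne'

theorem fderiv_softShift_rpow (hε : 0 < ε) (q y : ℝ) :
    fderiv ℝ (fun z : ℝ × ℝ => softShift ε z.2 ^ (z.1 - 1)) (q, y) (0, 1) =
      softShiftDeriv ε y * (q - 1) * softShift ε y ^ (q - 2) := by
  have h1 := ((contDiffAt_softShift_rpow hε (q, y)).differentiableAt one_ne_zero).hasFDerivAt
  have h2 : HasDerivAt (fun t : ℝ => (q, t)) ((0 : ℝ), (1 : ℝ)) y :=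
    (hasDerivAt_const y q).prodMk (hasDerivAt_id y)
  have h3 := h1.comp_hasDerivAt y h2
  have h4 := (hasDerivAt_softShift ε y).rpow_const (p := q - 1) (Or.inl (softShift_pos hε y).ne')
  rw [h3.unique h4, show q - 1 - 1 = q - 2 by ring]

/-- The coefficient of `∇φ` in the gradient of `|φ|^q / (softShift ε ∘ s)^{q-1}`, where `t` is the
value of `φ`. -/
noncomputable def piconeCoeffA (ε q t s : ℝ) : ℝ := q * (|t| ^ (q - 2) * t) / softShift ε s ^ (q - 1)

/-- Minus the coefficient of `∇s` in the gradient of `|φ|^q / (softShift ε ∘ s)^{q-1}`, where `t` is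
the value of `φ`. -/
noncomputable def piconeCoeffB (ε q t s : ℝ) : ℝ :=
  |t| ^ q * (softShiftDeriv ε s * (q - 1) * softShift ε s ^ (q - 2)) / (softShift ε s ^ (q - 1)) ^ 2

theorem continuous_piconeCoeffA (hε : 0 < ε) (q t : ℝ) : Continuous (piconeCoeffA ε q t) := by
  have h := (contDiff_softShift ε).continuous
  exact continuous_const.div (h.rpow_const fun s => Or.inl (softShift_pos hε s).ne')
    fun s => (Real.rpow_pos_of_pos (softShift_pos hε s) _).ne'

theorem continuous_piconeCoeffB (hε : 0 < ε) (q t : ℝ) : Continuous (piconeCoeffB ε q t) := by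
  have h := (contDiff_softShift ε).continuous
  have h1 : ∀ r : ℝ, Continuous fun s => softShift ε s ^ r := fun r =>
    h.rpow_const fun s => Or.inl (softShift_pos hε s).ne'
  refine Continuous.div (continuous_const.mul (((continuous_softShiftDeriv ε).mul
    continuous_const).mul (h1 _))) ((h1 _).pow 2) fun s => ?_
  have := Real.rpow_pos_of_pos (softShift_pos hε s) (q - 1)
  positivity

theorem inv_softShift_rpow_le (hε : 0 < ε) {q P : ℝ} (hq : 1 < q) (hP : q ≤ P) (s : ℝ) :
    (softShift ε s ^ (q - 1))⁻¹ ≤ (min (3 / 4 * ε) 1) ^ (-P) := by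
  have hm : 0 < min (3 / 4 * ε) 1 := lt_min (by positivity) one_pos
  rw [← Real.rpow_neg (softShift_pos hε s).le]
  calc softShift ε s ^ (-(q - 1)) ≤ (min (3 / 4 * ε) 1) ^ (-(q - 1)) :=
        Real.rpow_le_rpow_of_nonpos hm ((min_le_left _ _).trans (softShift_lower hε s))
          (by linarith)
    _ ≤ (min (3 / 4 * ε) 1) ^ (-P) :=
        Real.rpow_le_rpow_of_exponent_ge hm (min_le_right _ _) (by linarith)

theorem abs_rpow_le_of_le {q P t C r : ℝ} (hr : 0 ≤ r) (hrq : r ≤ q) (hP : q ≤ P) (ht : |t| ≤ C) :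
    |t| ^ r ≤ (1 + C) ^ P := by
  have hC : 0 ≤ C := (abs_nonneg t).trans ht
  calc |t| ^ r ≤ (1 + C) ^ r := Real.rpow_le_rpow (abs_nonneg t) (by linarith) hr
    _ ≤ (1 + C) ^ P := Real.rpow_le_rpow_of_exponent_le (by linarith) (hrq.trans hP)

theorem abs_piconeCoeffA_le (hε : 0 < ε) {q P t C : ℝ} (hq : 1 < q) (hP : q ≤ P) (ht : |t| ≤ C)
    (s : ℝ) : |piconeCoeffA ε q t s| ≤ P * (1 + C) ^ P * (min (3 / 4 * ε) 1) ^ (-P) := by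
  have hC : 0 ≤ C := (abs_nonneg t).trans ht
  have h1 : |(|t| ^ (q - 2) * t)| = |t| ^ (q - 1) := by
    rcases eq_or_ne t 0 with rfl | h
    · simp [Real.zero_rpow (sub_pos.2 hq).ne']
    · rw [abs_mul, abs_of_nonneg (by positivity : 0 ≤ |t| ^ (q - 2)),
        ← Real.rpow_add_one (abs_pos.2 h).ne']
      ring_nf
  have h2 := Real.rpow_pos_of_pos (softShift_pos hε s) (q - 1)
  rw [piconeCoeffA, abs_div, abs_mul, h1, abs_of_pos h2, abs_of_pos (zero_lt_one.trans hq),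
    div_eq_mul_inv]
  have h3 := abs_rpow_le_of_le (r := q - 1) (by linarith) (by linarith) hP ht
  have h4 := inv_softShift_rpow_le hε hq hP s
  have : 0 ≤ P := by linarith
  gcongr

theorem abs_piconeCoeffB_le (hε : 0 < ε) {q P t C : ℝ} (hq : 1 < q) (hP : q ≤ P) (ht : |t| ≤ C)
    (s : ℝ) :
    |piconeCoeffB ε q t s| ≤ (1 + C) ^ P * (2 / ε * P * (min (3 / 4 * ε) 1) ^ (-P)) := by
  have hC : 0 ≤ C := (abs_nonneg t).trans ht
  have hh := softShift_pos hε s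
  have h2 := Real.rpow_pos_of_pos hh (q - 1)
  have h3 : softShift ε s ^ (q - 2) = softShift ε s ^ (q - 1) * (softShift ε s)⁻¹ := by
    rw [show q - 2 = q - 1 - 1 by ring, Real.rpow_sub_one hh.ne', div_eq_mul_inv]
  have h4 : piconeCoeffB ε q t s = |t| ^ q * ((softShiftDeriv ε s * (softShift ε s)⁻¹) *
      (q - 1) * (softShift ε s ^ (q - 1))⁻¹) := by
    rw [piconeCoeffB, h3]
    field_simp
  have h5 : |softShiftDeriv ε s * (softShift ε s)⁻¹| ≤ 2 / ε := by
    rw [abs_mul, abs_inv, abs_of_pos hh, ← div_eq_mul_inv, div_le_iff₀ hh]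
    exact abs_softShiftDeriv_le hε s
  rw [h4, abs_mul, abs_mul, abs_mul, abs_of_pos (sub_pos.2 hq), abs_of_pos (inv_pos.2 h2),
    abs_of_nonneg (by positivity : 0 ≤ |t| ^ q)]
  have h6 := abs_rpow_le_of_le (r := q) (by linarith) le_rfl hP ht
  have h7 := inv_softShift_rpow_le hε hq hP s
  have : 0 ≤ P := by linarith
  have : q - 1 ≤ P := by linarith
  have : 0 ≤ q - 1 := by linarith
  gcongr

theorem aemeasurable_piconeCoeff {α : Type*} [MeasurableSpace α] {μ : Measure α} {q t s : α → ℝ}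
    (hq : AEMeasurable q μ) (ht : AEMeasurable t μ) (hs : AEMeasurable s μ) (ε : ℝ) :
    AEMeasurable (fun x => piconeCoeffA ε (q x) (t x) (s x)) μ ∧
      AEMeasurable (fun x => piconeCoeffB ε (q x) (t x) (s x)) μ := by
  have h1 : AEMeasurable (fun x => softShift ε (s x)) μ :=
    (contDiff_softShift ε).continuous.measurable.comp_aemeasurable hs
  have h2 : AEMeasurable (fun x => softShiftDeriv ε (s x)) μ :=
    (continuous_softShiftDeriv ε).measurable.comp_aemeasurable hs
  have h3 : AEMeasurable (fun x => |t x|) μ := continuous_abs.measurable.comp_aemeasurable ht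
  exact ⟨(hq.mul ((h3.pow (hq.sub_const 2)).mul ht)).div (h1.pow (hq.sub_const 1)),
    ((h3.pow hq).mul ((h2.mul (hq.sub_const 1)).mul (h1.pow (hq.sub_const 2)))).div
      ((h1.pow (hq.sub_const 1)).pow_const 2)⟩

end Shift

section SupSolution

open Filter Topology

theorem rpow_sub_one_mul_le {a b q : ℝ} (ha : 0 ≤ a) (hb : 0 ≤ b) (hq : 1 < q) :
    a ^ (q - 1) * b ≤ a ^ q + b ^ q := by
  have key : ∀ t : ℝ, 0 ≤ t → t ^ (q - 1) * t = t ^ q := fun t ht => by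
    rcases ht.eq_or_lt with rfl | h
    · simp [Real.zero_rpow (zero_lt_one.trans hq).ne']
    · rw [← Real.rpow_add_one h.ne']
      ring_nf
  have h1 : 0 ≤ a ^ q := by positivity
  have h2 : 0 ≤ b ^ q := by positivity
  rcases le_total a b with h | h
  · have : a ^ (q - 1) * b ≤ b ^ (q - 1) * b := by
      gcongr
    rw [key b hb] at this
    linarith
  · have : a ^ (q - 1) * b ≤ a ^ (q - 1) * a := by gcongr
    rw [key a ha] at this
    linarith

variable {n N : ℕ} {M : Type*} [TopologicalSpace M] [ChartedSpace (EuclideanSpace ℝ (Fin n)) M]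
  [IsManifold (𝓡 n) ∞ M] {X : Fin N → (x : M) → TangentSpace (𝓡 n) x}
  [T2Space M] [SecondCountableTopology M] [MeasurableSpace M] [BorelSpace M]

/-- The weak inequality for a positive sup-solution `v`, tested with `|φ|^p / (v + ε)^{p-1}` and
combined with Picone's inequality. The test function is not smooth, and is reached as a limit by
replacing `v` with test functions approximating it in `W₀^{1,p(·)}(Ω)`. -/
theorem IsPositiveSupSolution.picone_shift {vol : SmoothVolume n M}
    (hX : ∀ k, ContMDiff (𝓡 n) (𝓡 n).tangent ∞
      (fun x => (⟨x, X k x⟩ : TangentBundle (𝓡 n) M)))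
    {Ω : Set M} (hΩ : IsOpen Ω) [IsFiniteMeasure (vol.measure.restrict Ω)] {p : M → ℝ}
    (hp1 : ∀ x ∈ Ω, 1 < p x) {P : ℝ} (hP : ∀ x ∈ Ω, p x ≤ P)
    (hpd : ContMDiffOn (𝓡 n) 𝓘(ℝ, ℝ) 1 p Ω)
    {c : ℝ} {g v : M → ℝ} {G : M → EuclideanSpace ℝ (Fin N)} (hc : 0 < c)
    (hg : AEStronglyMeasurable g (vol.measure.restrict Ω)) (hg0 : ∀ x ∈ Ω, 0 < g x)
    (hgb : ∃ C : ℝ, ∀ x ∈ Ω, g x ≤ C) (hv : IsPositiveSupSolution X vol Ω p c g v G)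
    (hGp : ∀ᵐ x ∂(vol.measure.restrict Ω), inner ℝ (G x) (horizGrad X p x) = 0)
    {φ : M → ℝ} (hφ : IsTestFunction (n := n) Ω φ) {ε : ℝ} (hε : 0 < ε) :
    AEMeasurable (fun x => c * (g x * (|v x| ^ (p x - 2) * v x)) *
      (|φ x| ^ p x / softShift ε (v x) ^ (p x - 1))) (vol.measure.restrict Ω) ∧
    ∫⁻ x in Ω, ENNReal.ofReal (c * (g x * (|v x| ^ (p x - 2) * v x)) *
      (|φ x| ^ p x / softShift ε (v x) ^ (p x - 1))) ∂vol.measure ≤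
      ∫⁻ x in Ω, ENNReal.ofReal (‖horizGrad X φ x‖ ^ p x) ∂vol.measure := by
  set μ := vol.measure.restrict Ω with hμ
  have hmem : ∀ᵐ x ∂μ, x ∈ Ω := ae_restrict_mem hΩ.measurableSet
  have hpm : AEMeasurable p μ := hpd.continuousOn.aemeasurable hΩ.measurableSet
  have hp1' : ∀ᵐ x ∂μ, 1 < p x := hmem.mono hp1
  have hP' : ∀ᵐ x ∂μ, p x ≤ P := hmem.mono hP
  obtain ⟨⟨hvLp, hGLp, -⟩, -⟩ := hv.memW10
  have hGp1 := hGLp.integrable_rpow_sub_one hpm hp1'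
  have hGpi := hGLp.integrable_rpow hpm
  have hvp1 := hvLp.integrable_rpow_sub_one hpm hp1'
  have hvm : AEMeasurable v μ := hvLp.1.aemeasurable
  have hφ1 : ContMDiff (𝓡 n) 𝓘(ℝ, ℝ) 1 φ := hφ.1.of_le (by simp)
  have hφm : AEMeasurable φ μ := hφ.1.continuous.aemeasurable
  obtain ⟨Cφ, hCφ⟩ := exists_bound_of_continuous_of_eq_zero hφ.2.1.isCompact
    hφ.1.continuous.continuousOn fun x hx => image_eq_zero_of_notMem_tsupport hx
  obtain ⟨Cd, hCd⟩ := exists_bound_horizGrad hX hφ1 hφ.2.1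
  obtain ⟨Cg, hCg⟩ := hgb
  -- the weight
  set w : M → ℝ := fun x => c * (g x * (|v x| ^ (p x - 2) * v x)) with hw
  have hwm : AEMeasurable w μ := (hg.aemeasurable.mul
    (((continuous_abs.measurable.comp_aemeasurable hvm).pow (hpm.sub_const 2)).mul hvm)).const_mul c
  have hwi : Integrable w μ := by
    refine (hvp1.const_mul (c * Cg)).mono' hwm.aestronglyMeasurable ?_
    filter_upwards [hmem, hv.pos] with x hx hvx
    have h1 : |v x| ^ (p x - 2) * v x = ‖v x‖ ^ (p x - 1) := by
      rw [Real.norm_eq_abs, abs_of_pos hvx, ← Real.rpow_add_one hvx.ne']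
      ring_nf
    have := hg0 x hx
    rw [hw, Real.norm_of_nonneg (by simp only [h1]; positivity)]
    simp only [h1]
    rw [mul_assoc]
    gcongr
    exact hCg x hx
  -- test functions converging fast to `v`
  choose V hV hVv hVG using fun k : ℕ =>
    hv.memW10.exists_test_modular hX hpm hp1' hP' (ε := (1 / 2 : ℝ) ^ k) (by positivity)
  have hV1 : ∀ k, ContMDiff (𝓡 n) 𝓘(ℝ, ℝ) 1 (V k) := fun k => (hV k).1.of_le (by simp)
  have hVm : ∀ k, AEMeasurable (V k) μ := fun k => (hV k).1.continuous.aemeasurable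
  have hdVm : ∀ k, AEStronglyMeasurable (horizGrad X (V k)) μ := fun k =>
    (continuous_horizGrad hX (hV1 k)).aestronglyMeasurable
  have hdφm : AEStronglyMeasurable (horizGrad X φ) μ :=
    (continuous_horizGrad hX hφ1).aestronglyMeasurable
  have hVlim : ∀ᵐ x ∂μ, Tendsto (fun k => V k x) atTop (𝓝 (v x)) :=
    ae_tendsto_of_modular_le_one hp1' hpm hvLp.1 (fun k => (hVm k).aestronglyMeasurable) hVv
  -- bounds for the coefficients
  set A : ℝ → M → ℝ := fun s x => piconeCoeffA ε (p x) (φ x) s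
  set B : ℝ → M → ℝ := fun s x => piconeCoeffB ε (p x) (φ x) s
  obtain ⟨C, hC0, hA, hB⟩ : ∃ C : ℝ, 0 ≤ C ∧ (∀ x ∈ Ω, ∀ s, |A s x| ≤ C) ∧
      ∀ x ∈ Ω, ∀ s, |B s x| ≤ C :=
    ⟨max (max (P * (1 + Cφ) ^ P * (min (3 / 4 * ε) 1) ^ (-P))
      ((1 + Cφ) ^ P * (2 / ε * P * (min (3 / 4 * ε) 1) ^ (-P)))) 0, le_max_right _ _,
      fun x hx s => (abs_piconeCoeffA_le hε (hp1 x hx) (hP x hx) (hCφ x) s).trans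
        ((le_max_left _ _).trans (le_max_left _ _)),
      fun x hx s => (abs_piconeCoeffB_le hε (hp1 x hx) (hP x hx) (hCφ x) s).trans
        ((le_max_right _ _).trans (le_max_left _ _))⟩
  have hABm : ∀ s : M → ℝ, AEMeasurable s μ →
      AEMeasurable (fun x => A (s x) x) μ ∧ AEMeasurable (fun x => B (s x) x) μ := fun s hs =>
    aemeasurable_piconeCoeff hpm hφm hs ε
  set R : (M → ℝ) → M → ℝ := fun s x => ‖G x‖ ^ (p x - 2) *
    inner ℝ (G x) (A (s x) x • horizGrad X φ x - B (s x) x • G x) with hR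
  set bd : M → ℝ := fun x => C * Cd * ‖G x‖ ^ (p x - 1) + C * ‖G x‖ ^ p x with hbd
  have hbdi : Integrable bd μ := (hGp1.const_mul _).add (hGpi.const_mul _)
  have hRm : ∀ s : M → ℝ, AEMeasurable s μ → AEStronglyMeasurable (R s) μ := fun s hs =>
    aestronglyMeasurable_form hpm hGLp.1 (((hABm s hs).1.aestronglyMeasurable.smul hdφm).sub
      ((hABm s hs).2.aestronglyMeasurable.smul hGLp.1))
  have hRb : ∀ s : M → ℝ, ∀ᵐ x ∂μ, ‖R s x‖ ≤ bd x := by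
    intro s
    filter_upwards [hmem] with x hx
    refine (abs_rpow_mul_inner_le _ _ _).trans ?_
    have h1 : ‖A (s x) x • horizGrad X φ x - B (s x) x • G x‖ ≤ C * Cd + C * ‖G x‖ := by
      refine (norm_sub_le _ _).trans ?_
      rw [norm_smul, norm_smul]
      exact add_le_add (mul_le_mul (hA x hx _) (hCd x) (norm_nonneg _) hC0)
        (mul_le_mul_of_nonneg_right (hB x hx _) (norm_nonneg _))
    have h2 : ‖G x‖ ^ (p x - 1) * ‖G x‖ = ‖G x‖ ^ p x := by
      rcases eq_or_ne ‖G x‖ 0 with h | h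
      · rw [h, mul_zero, Real.zero_rpow (zero_lt_one.trans (hp1 x hx)).ne']
      · rw [← Real.rpow_add_one h]
        ring_nf
    calc ‖G x‖ ^ (p x - 1) * ‖A (s x) x • horizGrad X φ x - B (s x) x • G x‖
        ≤ ‖G x‖ ^ (p x - 1) * (C * Cd + C * ‖G x‖) := by gcongr
      _ = C * Cd * ‖G x‖ ^ (p x - 1) + C * (‖G x‖ ^ (p x - 1) * ‖G x‖) := by ring
      _ = bd x := by rw [h2]
  have hRlim : Tendsto (fun k => ∫ x, R (V k) x ∂μ) atTop (𝓝 (∫ x, R v x ∂μ)) := by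
    refine tendsto_integral_of_dominated_convergence bd (fun k => hRm _ (hVm k)) hbdi
      (fun k => hRb _) ?_
    filter_upwards [hVlim] with x hx
    have h1 := ((continuous_piconeCoeffA hε (p x) (φ x)).tendsto (v x)).comp hx
    have h2 := ((continuous_piconeCoeffB hε (p x) (φ x)).tendsto (v x)).comp hx
    exact ((tendsto_const_nhds.inner ((h1.smul_const _).sub (h2.smul_const _)))).const_mul _
  -- the remainder coming from `∇ (V k) - G`
  set S : ℕ → M → ℝ := fun k x => B (V k x) x *
    (‖G x‖ ^ (p x - 2) * inner ℝ (G x) (G x - horizGrad X (V k) x)) with hS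
  set D : ℕ → M → EuclideanSpace ℝ (Fin N) := fun k x =>
    ((1 / 2 : ℝ) ^ k)⁻¹ • (G x - horizGrad X (V k) x) with hD
  have hDm : ∀ k, AEStronglyMeasurable (D k) μ := fun k =>
    (hGLp.1.sub (hdVm k)).const_smul ((1 / 2 : ℝ) ^ k)⁻¹
  have hDLp : ∀ k, MemVarLp vol Ω p (D k) := fun k =>
    ⟨hDm k, (hVG k).trans_lt ENNReal.one_lt_top⟩
  have hDi : ∀ k, Integrable (fun x => ‖D k x‖ ^ p x) μ := fun k => (hDLp k).integrable_rpow hpm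
  have hD1 : ∀ k, ∫ x, ‖D k x‖ ^ p x ∂μ ≤ 1 := by
    intro k
    rw [integral_eq_lintegral_of_nonneg_ae (Eventually.of_forall fun x => by positivity)
      (hDi k).aestronglyMeasurable]
    exact ENNReal.toReal_le_of_le_ofReal zero_le_one (by
      rw [ENNReal.ofReal_one]
      exact hVG k)
  have hSb : ∀ k, ∀ᵐ x ∂μ, ‖S k x‖ ≤ C * (1 / 2 : ℝ) ^ k * (‖G x‖ ^ p x + ‖D k x‖ ^ p x) := by
    intro k
    filter_upwards [hmem] with x hx
    have hk : (0 : ℝ) < (1 / 2) ^ k := by positivity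
    have h1 : ‖G x - horizGrad X (V k) x‖ = (1 / 2 : ℝ) ^ k * ‖D k x‖ := by
      rw [hD, norm_smul, Real.norm_of_nonneg (by positivity), mul_inv_cancel_left₀ hk.ne']
    rw [hS, norm_mul]
    calc ‖B (V k x) x‖ * ‖‖G x‖ ^ (p x - 2) * inner ℝ (G x) (G x - horizGrad X (V k) x)‖
        ≤ C * (‖G x‖ ^ (p x - 1) * ‖G x - horizGrad X (V k) x‖) :=
          mul_le_mul (hB x hx _) (abs_rpow_mul_inner_le _ _ _) (norm_nonneg _) hC0
      _ = C * (1 / 2 : ℝ) ^ k * (‖G x‖ ^ (p x - 1) * ‖D k x‖) := by rw [h1]; ring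
      _ ≤ _ := by
          gcongr
          exact rpow_sub_one_mul_le (norm_nonneg _) (norm_nonneg _) (hp1 x hx)
  have hSi : ∀ k, Integrable (S k) μ := fun k =>
    ((hGpi.add (hDi k)).const_mul (C * (1 / 2 : ℝ) ^ k)).mono'
      ((hABm _ (hVm k)).2.aestronglyMeasurable.mul
        (aestronglyMeasurable_form hpm hGLp.1 (hGLp.1.sub (hdVm k)))) (hSb k)
  have hSle : ∀ k, ∫ x, S k x ∂μ ≤ C * (1 / 2 : ℝ) ^ k * (∫ x, ‖G x‖ ^ p x ∂μ + 1) := by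
    intro k
    calc ∫ x, S k x ∂μ ≤ ∫ x, C * (1 / 2 : ℝ) ^ k * (‖G x‖ ^ p x + ‖D k x‖ ^ p x) ∂μ :=
          integral_mono_ae (hSi k) ((hGpi.add (hDi k)).const_mul _)
            ((hSb k).mono fun x hx => (le_abs_self _).trans hx)
      _ = C * (1 / 2 : ℝ) ^ k * (∫ x, ‖G x‖ ^ p x ∂μ + ∫ x, ‖D k x‖ ^ p x ∂μ) := by
          rw [integral_const_mul, integral_add hGpi (hDi k)]
      _ ≤ _ := by
          gcongr
          exact hD1 k
  -- the left hand sides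
  set Q : (M → ℝ) → M → ℝ := fun s x =>
    w x * (|φ x| ^ p x / softShift ε (s x) ^ (p x - 1)) with hQ
  have hQm : ∀ s : M → ℝ, AEMeasurable s μ → AEMeasurable (Q s) μ := fun s hs =>
    hwm.mul (((continuous_abs.measurable.comp_aemeasurable hφm).pow hpm).div
      (((contDiff_softShift ε).continuous.measurable.comp_aemeasurable hs).pow (hpm.sub_const 1)))
  have hQb : ∀ s : M → ℝ, ∀ᵐ x ∂μ, ‖Q s x‖ ≤
      (1 + Cφ) ^ P * (min (3 / 4 * ε) 1) ^ (-P) * ‖w x‖ := by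
    intro s
    filter_upwards [hmem] with x hx
    have h1 := Real.rpow_pos_of_pos (softShift_pos hε (s x)) (p x - 1)
    have h2 := inv_softShift_rpow_le hε (hp1 x hx) (hP x hx) (s x)
    have h3 := abs_rpow_le_of_le (r := p x) (zero_lt_one.trans (hp1 x hx)).le le_rfl (hP x hx)
      (hCφ x)
    have h4 : 0 ≤ Cφ := (norm_nonneg _).trans (hCφ x)
    rw [hQ, norm_mul, mul_comm ‖w x‖, Real.norm_of_nonneg (by positivity), div_eq_mul_inv]
    gcongr
  have hQi : Integrable (Q v) μ := (hwi.norm.const_mul _).mono' (hQm v hvm).aestronglyMeasurable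
    (hQb v)
  have hQlim : Tendsto (fun k => ∫ x, Q (V k) x ∂μ) atTop (𝓝 (∫ x, Q v x ∂μ)) := by
    refine tendsto_integral_of_dominated_convergence _
      (fun k => (hQm _ (hVm k)).aestronglyMeasurable) (hwi.norm.const_mul _) (fun k => hQb _) ?_
    filter_upwards [hVlim] with x hx
    have h1 := ((contDiff_softShift ε).continuous.tendsto (v x)).comp hx
    have h2 := h1.rpow_const (p := p x - 1) (Or.inl (softShift_pos hε _).ne')
    exact ((tendsto_const_nhds (x := |φ x| ^ p x)).div h2 (Real.rpow_pos_of_pos (softShift_pos hε _) _).ne').const_mul _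
  have hkey : ∀ k, ∫ x, Q (V k) x ∂μ ≤
      ∫ x, R (V k) x ∂μ + C * (1 / 2 : ℝ) ^ k * (∫ x, ‖G x‖ ^ p x ∂μ + 1) := by
    intro k
    have h1 := (picone_weak_ineq hX hΩ hp1 hpd hGLp.1 hGp1 hGp (w := w)
      (fun K hK _ => by
        have h : IntegrableOn w Ω vol.measure := hwi
        exact h.mono_set hK)
      (fun ψ hψ hψ0 => by
        refine le_trans (le_of_eq ?_) (hv.weak_ge ψ hψ hψ0)
        rw [← integral_const_mul]
        exact integral_congr_ae (Eventually.of_forall fun x => by simp only [hw]; ring))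
      (F := fun z => softShift ε z.2 ^ (z.1 - 1)) hφ1.contMDiffOn (hV1 k).contMDiffOn
      (fun x _ => contDiffAt_softShift_rpow hε _)
      (fun x _ => Real.rpow_pos_of_pos (softShift_pos hε _) _) hφ.2.1.isCompact hφ.2.2
      (fun x _ hx => image_eq_zero_of_notMem_tsupport hx)).2
    refine h1.trans ?_
    refine le_trans (le_of_eq ?_) (add_le_add le_rfl (hSle k))
    have hRi : Integrable (R (V k)) μ := hbdi.mono' (hRm _ (hVm k)) (hRb _)
    rw [← integral_add hRi (hSi k)]
    refine integral_congr_ae (Eventually.of_forall fun x => ?_)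
    simp only [fderiv_softShift_rpow hε, hR, hS]
    change ‖G x‖ ^ (p x - 2) * inner ℝ (G x) (A (V k x) x • horizGrad X φ x -
      B (V k x) x • horizGrad X (V k) x) = _
    simp only [inner_sub_right, inner_smul_right]
    ring
  have hle : ∫ x, Q v x ∂μ ≤ ∫ x, R v x ∂μ := by
    refine le_of_tendsto_of_tendsto' hQlim ?_ hkey
    have h1 : Tendsto (fun k : ℕ => (1 / 2 : ℝ) ^ k) atTop (𝓝 0) :=
      tendsto_pow_atTop_nhds_zero_of_lt_one (by norm_num) (by norm_num)
    simpa using hRlim.add ((h1.const_mul C).mul_const (∫ x, ‖G x‖ ^ p x ∂μ + 1))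
  refine ⟨hQm v hvm, ?_⟩
  calc ∫⁻ x, ENNReal.ofReal (Q v x) ∂μ = ENNReal.ofReal (∫ x, Q v x ∂μ) := by
        refine (ofReal_integral_eq_lintegral_ofReal hQi ?_).symm
        filter_upwards [hmem, hv.pos] with x hx hvx
        have := hg0 x hx
        have := Real.rpow_pos_of_pos (softShift_pos hε (v x)) (p x - 1)
        simp only [hQ, hw, Pi.zero_apply]
        positivity
    _ ≤ ENNReal.ofReal (∫ x, R v x ∂μ) := ENNReal.ofReal_le_ofReal hle
    _ ≤ ∫⁻ x, ENNReal.ofReal (R v x) ∂μ :=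
        ofReal_integral_le_lintegral (hbdi.mono' (hRm _ hvm) (hRb _))
    _ ≤ ∫⁻ x, ENNReal.ofReal (‖horizGrad X φ x‖ ^ p x) ∂μ := by
        refine lintegral_mono_ae ?_
        filter_upwards [hmem, hv.pos] with x hx hvx
        have hh := softShift_pos hε (v x)
        refine ENNReal.ofReal_le_ofReal (picone_pointwise _ _ (hp1 x hx)
          (Real.rpow_pos_of_pos hh _) (le_of_eq ?_))
        have hp' : p x - 1 ≠ 0 := (sub_pos.2 (hp1 x hx)).ne'
        rw [softShiftDeriv_of_nonneg hvx.le, ← Real.rpow_mul hh.le, mul_div_cancel₀ _ hp', one_mul]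

/-- The Hardy inequality of a sup-solution for test functions of any sign. -/
theorem IsPositiveSupSolution.hardy_test {vol : SmoothVolume n M}
    (hX : ∀ k, ContMDiff (𝓡 n) (𝓡 n).tangent ∞
      (fun x => (⟨x, X k x⟩ : TangentBundle (𝓡 n) M)))
    {Ω : Set M} (hΩ : IsOpen Ω) [IsFiniteMeasure (vol.measure.restrict Ω)] {p : M → ℝ}
    (hp1 : ∀ x ∈ Ω, 1 < p x) {P : ℝ} (hP : ∀ x ∈ Ω, p x ≤ P)
    (hpd : ContMDiffOn (𝓡 n) 𝓘(ℝ, ℝ) 1 p Ω)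
    {c : ℝ} {g v : M → ℝ} {G : M → EuclideanSpace ℝ (Fin N)} (hc : 0 < c)
    (hg : AEStronglyMeasurable g (vol.measure.restrict Ω)) (hg0 : ∀ x ∈ Ω, 0 < g x)
    (hgb : ∃ C : ℝ, ∀ x ∈ Ω, g x ≤ C) (hv : IsPositiveSupSolution X vol Ω p c g v G)
    (hGp : ∀ᵐ x ∂(vol.measure.restrict Ω), inner ℝ (G x) (horizGrad X p x) = 0)
    {φ : M → ℝ} (hφ : IsTestFunction (n := n) Ω φ) :
    ENNReal.ofReal c * ∫⁻ x in Ω, ENNReal.ofReal (g x * |φ x| ^ p x) ∂vol.measure ≤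
      modular vol Ω p (horizGrad X φ) := by
  have hmem : ∀ᵐ x ∂(vol.measure.restrict Ω), x ∈ Ω := ae_restrict_mem hΩ.measurableSet
  have hε := fun k : ℕ => hv.picone_shift hX hΩ hp1 hP hpd hc hg hg0 hgb hGp hφ
    (Nat.one_div_pos_of_nat (α := ℝ) (n := k))
  rw [← lintegral_const_mul' _ _ ENNReal.ofReal_ne_top]
  refine lintegral_le_of_ae_tendsto (fun k => (hε k).1.ennreal_ofReal) ?_ (fun k => (hε k).2)
    tendsto_const_nhds
  filter_upwards [hmem, hv.pos] with x hx hvx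
  rw [← ENNReal.ofReal_mul hc.le]
  refine ENNReal.tendsto_ofReal ?_
  have h1 : |v x| ^ (p x - 2) * v x = v x ^ (p x - 1) := by
    rw [abs_of_pos hvx, ← Real.rpow_add_one hvx.ne']
    ring_nf
  have h2 : Tendsto (fun k : ℕ => softShift (1 / ((k : ℝ) + 1)) (v x)) atTop (𝓝 (v x)) := by
    simp only [softShift_of_nonneg hvx.le]
    simpa using tendsto_one_div_add_atTop_nhds_zero_nat.const_add (v x)
  have h3 := Real.rpow_pos_of_pos hvx (p x - 1)
  have h4 := ((tendsto_const_nhds (x := |φ x| ^ p x)).div (h2.rpow_const (p := p x - 1)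
    (Or.inl hvx.ne')) h3.ne').const_mul (c * (g x * (|v x| ^ (p x - 2) * v x)))
  convert! h4 using 2
  rw [h1]
  field_simp

theorem IsPositiveSupSolution.hardy {vol : SmoothVolume n M}
    (hX : ∀ k, ContMDiff (𝓡 n) (𝓡 n).tangent ∞
      (fun x => (⟨x, X k x⟩ : TangentBundle (𝓡 n) M)))
    {Ω : Set M} (hΩ : IsOpen Ω) [IsFiniteMeasure (vol.measure.restrict Ω)] {p : M → ℝ}
    (hp1 : ∀ x ∈ Ω, 1 < p x) {P : ℝ} (hP : ∀ x ∈ Ω, p x ≤ P)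
    (hpd : ContMDiffOn (𝓡 n) 𝓘(ℝ, ℝ) 1 p Ω)
    {c : ℝ} {g v : M → ℝ} {G : M → EuclideanSpace ℝ (Fin N)} (hc : 0 < c)
    (hg : AEStronglyMeasurable g (vol.measure.restrict Ω)) (hg0 : ∀ x ∈ Ω, 0 < g x)
    (hgb : ∃ C : ℝ, ∀ x ∈ Ω, g x ≤ C) (hv : IsPositiveSupSolution X vol Ω p c g v G)
    (hGp : ∀ᵐ x ∂(vol.measure.restrict Ω), inner ℝ (G x) (horizGrad X p x) = 0)
    {u : M → ℝ} {U : M → EuclideanSpace ℝ (Fin N)} (hu : MemW10 X vol Ω p u U) :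
    ENNReal.ofReal c * ∫⁻ x in Ω, ENNReal.ofReal (g x * |u x| ^ p x) ∂vol.measure ≤
      modular vol Ω p U := by
  have hmem : ∀ᵐ x ∂(vol.measure.restrict Ω), x ∈ Ω := ae_restrict_mem hΩ.measurableSet
  have hpm : AEMeasurable p (vol.measure.restrict Ω) :=
    hpd.continuousOn.aemeasurable hΩ.measurableSet
  have hp1' := hmem.mono hp1
  have hP' := hmem.mono hP
  choose φ hφ hφu hφU using fun k : ℕ =>
    hu.exists_test_modular hX hpm hp1' hP' (ε := (1 / 2 : ℝ) ^ k) (by positivity)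
  have hφm : ∀ k, AEMeasurable (φ k) (vol.measure.restrict Ω) := fun k =>
    (hφ k).1.continuous.aemeasurable
  have hlim := ae_tendsto_of_modular_le_one hp1' hpm hu.1.1.1
    (fun k => (hφm k).aestronglyMeasurable) hφu
  have hpow : Tendsto (fun k : ℕ => (1 / 2 : ℝ) ^ (k + 1)) atTop (𝓝 0) :=
    (tendsto_pow_atTop_nhds_zero_of_lt_one (by norm_num) (by norm_num)).comp (tendsto_add_atTop_nat 1)
  rw [← lintegral_const_mul' _ _ ENNReal.ofReal_ne_top]
  -- the index is shifted so that the approximation parameter is less than one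
  refine lintegral_le_of_ae_tendsto (f := fun k x => ENNReal.ofReal c *
    ENNReal.ofReal (g x * |φ (k + 1) x| ^ p x))
    (b := fun k => ENNReal.ofReal ((1 - (1 / 2 : ℝ) ^ (k + 1)) ^ (1 - P)) * modular vol Ω p U +
      ENNReal.ofReal ((1 / 2 : ℝ) ^ (k + 1))) (fun k => ?_) ?_ (fun k => ?_) ?_
  · exact ((hg.aemeasurable.mul ((continuous_abs.measurable.comp_aemeasurable
      (hφm (k + 1))).pow hpm)).ennreal_ofReal).const_mul _
  · filter_upwards [hlim, hp1'] with x hx hpx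
    refine ENNReal.Tendsto.const_mul (ENNReal.tendsto_ofReal ?_) (Or.inr ENNReal.ofReal_ne_top)
    exact (((hx.comp (tendsto_add_atTop_nat 1)).abs).rpow_const
      (Or.inr (zero_lt_one.trans hpx).le)).const_mul _
  · rw [lintegral_const_mul' _ _ ENNReal.ofReal_ne_top]
    refine (hv.hardy_test hX hΩ hp1 hP hpd hc hg hg0 hgb hGp (hφ (k + 1))).trans ?_
    exact modular_le_of_modular_sub_le_one hp1' hP' hpm hu.1.2.1.1 (by positivity)
      (pow_lt_one₀ (by norm_num) (by norm_num) (Nat.succ_ne_zero k)) (hφU (k + 1))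
  · have h1 : Tendsto (fun k : ℕ => (1 - (1 / 2 : ℝ) ^ (k + 1)) ^ (1 - P)) atTop (𝓝 1) := by
      have := (hpow.const_sub 1).rpow_const (p := 1 - P) (Or.inl (by norm_num))
      simpa using this
    have h2 := (ENNReal.Tendsto.mul_const (ENNReal.tendsto_ofReal h1)
      (Or.inr hu.1.2.1.2.ne)).add (ENNReal.tendsto_ofReal hpow)
    simpa using h2

end SupSolution

theorem mainTheorem2 {n N : ℕ} {M : Type*} [TopologicalSpace M] [T2Space M]
    [SecondCountableTopology M] [ChartedSpace (EuclideanSpace ℝ (Fin n)) M]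
    [IsManifold (𝓡 n) ∞ M] [MeasurableSpace M] [BorelSpace M]
    (vol : SmoothVolume n M)
    (X : Fin N → (x : M) → TangentSpace (𝓡 n) x)
    (hX : ∀ k, ContMDiff (𝓡 n) (𝓡 n).tangent ∞
      (fun x => (⟨x, X k x⟩ : TangentBundle (𝓡 n) M)))
    (Ω : Set M) (hΩ : IsOpen Ω) (hΩb : IsCompact (closure Ω))
    (p : M → ℝ) (hpc : ContinuousOn p (closure Ω)) (hp1 : ∀ x ∈ closure Ω, 1 < p x)
    (hpd : ContMDiffOn (𝓡 n) 𝓘(ℝ, ℝ) 1 p Ω) :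
    -- Hardy type inequality from a positive solution
    (∀ (μ : ℝ) (a : M → ℝ) (f : ℝ → ℝ) (v : M → ℝ),
      0 < μ → ContinuousOn a Ω → (∀ x ∈ Ω, 0 < a x) → PiconeGrowth Ω p f →
      IsPositiveSolution X vol Ω p μ a f v →
      (∀ x ∈ Ω, inner ℝ (horizGrad X v x) (horizGrad X p x) = 0) →
      ∀ u : M → ℝ, IsC1Zero (n := n) Ω u → (∀ x ∈ Ω, 0 ≤ u x) →
        ENNReal.ofReal μ * ∫⁻ x in Ω, ENNReal.ofReal (a x * |u x| ^ p x) ∂vol.measure ≤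
          ∫⁻ x in Ω, ENNReal.ofReal (‖horizGrad X u x‖ ^ p x) ∂vol.measure) ∧
    -- the same inequality on the whole Sobolev space, from a positive sup-solution
    (∀ (lam : ℝ) (g : M → ℝ) (v : M → ℝ) (G : M → EuclideanSpace ℝ (Fin N)),
      0 < lam → AEStronglyMeasurable g (vol.measure.restrict Ω) → (∀ x ∈ Ω, 0 < g x) →
      (∃ C : ℝ, ∀ x ∈ Ω, g x ≤ C) →
      IsPositiveSupSolution X vol Ω p lam g v G →
      (∀ᵐ x ∂(vol.measure.restrict Ω), inner ℝ (G x) (horizGrad X p x) = 0) →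
      ∀ (u : M → ℝ) (U : M → EuclideanSpace ℝ (Fin N)), MemW10 X vol Ω p u U →
        ENNReal.ofReal lam * ∫⁻ x in Ω, ENNReal.ofReal (g x * |u x| ^ p x) ∂vol.measure ≤
          ∫⁻ x in Ω, ENNReal.ofReal (‖U x‖ ^ p x) ∂vol.measure) := by
  have := vol.isLocallyFiniteMeasure
  have hfin : IsFiniteMeasure (vol.measure.restrict Ω) :=
    isFiniteMeasure_restrict.2 (measure_lt_top_mono subset_closure hΩb.measure_lt_top).ne
  have hp1' : ∀ x ∈ Ω, 1 < p x := fun x hx => hp1 x (subset_closure hx)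
  obtain ⟨P, hP⟩ := (hΩb.image_of_continuousOn hpc).bddAbove
  have hP' : ∀ x ∈ Ω, p x ≤ P := fun x hx => hP (mem_image_of_mem p (subset_closure hx))
  exact ⟨fun μ a f v hμ ha ha0 hf hv hvp u hu hu0 =>
      hardy_of_isC1Zero hX hΩ hΩb hp1' hpd hμ ha ha0 hf hv hvp hu hu0,
    fun lam g v G hlam hg hg0 hgb hv hGp u U hu =>
      hv.hardy hX hΩ hp1' hP' hpd hlam hg hg0 hgb hGp hu⟩
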